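/- **Theorem (Universality).** Fix a countably infinite set of qubit variables. An environment $\Gamma$ is a finite set of variables, with state space $\mathcal H_\Gamma=\bigotimes_{q\in\Gamma}\mathbb C^2$; write $q,\Gamma$ for $\{q\}\cup\Gamma$ when $q\notin\Gamma$. Statements are generated by $$S::=\mathbf{skip}\mid\mathbf{new\ qbit}\ q\mid\mathbf{discard}\ q\mid q\mathbin{*{=}}U\mid S_0;S_1\mid\mathbf{meas}\ q\,(0\to S_0,1\to S_1)\mid\mathbf{while}\ q\ \mathbf{do}\ S\mid\mathbf{qcase}\ q\,(0\to S_0,1\to S_1),$$ where $U$ is any $2\times2$ unitary matrix. The judgment $\Gamma\vdash S\triangleright\Delta$ (in words: $(\Gamma;S;\Delta)$ is a program) is defined inductively by: - $\Gamma\vdash\mathbf{skip}\triangleright\Gamma$; $\ \Gamma\vdash\mathbf{new\ qbit}\ q\triangleright q,\Gamma$; $\ q,\Gamma\vdash\mathbf{discard}\ q\triangleright\Gamma$; $\ q,\Gamma\vdash q\mathbin{*{=}}U\triangleright q,\Gamma$; - if $\Gamma\vdash S_0\triangleright\Gamma'$ and $\Gamma'\vdash S_1\triangleright\Gamma''$,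 then $\Gamma\vdash S_0;S_1\triangleright\Gamma''$; - if $q,\Gamma\vdash S_i\triangleright\Gamma'$ for $i=0,1$, then $q,\Gamma\vdash\mathbf{meas}\ q\,(0\to S_0,1\to S_1)\triangleright\Gamma'$; - if $q,\Gamma\vdash S\triangleright q,\Gamma$, then $q,\Gamma\vdash\mathbf{while}\ q\ \mathbf{do}\ S\triangleright q,\Gamma$; - if $\Gamma\vdash S_i\triangleright\Gamma'$ for $i=0,1$ and $q$ does not appear in $S_0$ or $S_1$, then $q,\Gamma\vdash\mathbf{qcase}\ q\,(0\to S_0,1\to S_1)\triangleright q,\Gamma'$. A quantum operation is a completely positive, trace non-increasing linear map $\mathcal L(\mathcal H_A)\to\mathcal L(\mathcal H_B)$. Let $\mathcal K_{\Gamma;\Delta}$ be the set of pairs $(\mathcal C,F)$, where $\mathcal C$ is a quantum operation from $\mathcal H_\Gamma$ to $\mathcal H_\Delta$ and $F:\mathcal H_\Gamma\to\mathcal H_\Delta$ is linear, such that the map $$\tilde{\mathcal C}^F:\begin{bmatrix}A&B\\ C&D\end{bmatrix}\mapsto\begin{bmatrix}\mathcal C(A)&FB\\ CF^\dagger&D\end{bmatrix}$$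 is a quantum operation from $\mathcal H_\Gamma\oplus\mathbb C$ to $\mathcal H_\Delta\oplus\mathbb C$ (the summand $\mathbb C$ is the vacuum; $\tilde{\mathcal C}^F$ is a vacuum extension of $\mathcal C$ that is trace preserving on the vacuum). Order $\mathcal K_{\Gamma;\Delta}$ by $(\mathcal C,F)\le(\mathcal D,G)$ iff $(\tilde{\mathcal D}^G\otimes\mathcal I_E)(\rho)-(\tilde{\mathcal C}^F\otimes\mathcal I_E)(\rho)$ is positive semidefinite for every finite-dimensional $\mathcal H_E$ and every density matrix $\rho$ (positive semidefinite, trace at most $1$). Let $(\mathcal D,G)\circ(\mathcal C,F)=(\mathcal D\circ\mathcal C,GF)$. The interpretation $[\![S]\!]_\Gamma$ of a program $(\Gamma;S;\Delta)$ is defined by recursion. Here $\mathcal P_k(\rho)=|k\rangle\langle k|_q\,\rho\,|k\rangle\langle k|_q$, and $U_q$ is $U$ on the qubit $q$ and the identity elsewhere. - $[\![\mathbf{skip}]\!]_\Gamma=(\mathcal I_\Gamma,I_\Gamma)$; $\ [\![\mathbf{new\ qbit}\ q]\!]_\Gamma=(|0\rangle\langle0|_q\otimes\mathcal I_\Gamma,\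 |0\rangle_q\otimes I_\Gamma)$; $\ [\![\mathbf{discard}\ q]\!]_{q,\Gamma}=(\mathrm{Tr}_q,\ \langle0|_q\otimes I_\Gamma)$; $\ [\![q\mathbin{*{=}}U]\!]_{q,\Gamma}=(U_q(\cdot)U_q^\dagger,\ U_q)$; - $[\![S_0;S_1]\!]_\Gamma=[\![S_1]\!]_{\Gamma'}\circ[\![S_0]\!]_\Gamma$, where $\Gamma\vdash S_0\triangleright\Gamma'$; - $[\![\mathbf{meas}\ q\,(0\to S_0,1\to S_1)]\!]_{q,\Gamma}=\overline{\mathbf{meas}}_q\bigl[[\![S_0]\!]_{q,\Gamma},[\![S_1]\!]_{q,\Gamma}\bigr]$, where $\overline{\mathbf{meas}}_q[(\mathcal C_0,F_0),(\mathcal C_1,F_1)]=(\mathcal C_0\circ\mathcal P_0+\mathcal C_1\circ\mathcal P_1,\ F_0|0\rangle\langle0|_q)$; - $[\![\mathbf{while}\ q\ \mathbf{do}\ S]\!]_{q,\Gamma}$ is the least fixed point in $\mathcal K_{q,\Gamma;q,\Gamma}$ of $p\mapsto\overline{\mathbf{meas}}_q\bigl[(\mathcal I_{q,\Gamma},I_{q,\Gamma}),\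 p\circ[\![S]\!]_{q,\Gamma}\bigr]$; - if $[\![S_i]\!]_\Gamma=(\mathcal C_i,F_i)$ for $i=0,1$, then, writing the control qubit $q$ first, $$[\![\mathbf{qcase}\ q\,(0\to S_0,1\to S_1)]\!]_{q,\Gamma}=\left(\begin{bmatrix}A&B\\ C&D\end{bmatrix}\mapsto\begin{bmatrix}\mathcal C_0(A)&F_0BF_1^\dagger\\ F_1CF_0^\dagger&\mathcal C_1(D)\end{bmatrix},\ \begin{bmatrix}F_0&0\\0&F_1\end{bmatrix}\right).$$ Then for all environments $\Gamma,\Delta$ and every $(\mathcal C,F)\in\mathcal K_{\Gamma;\Delta}$ there is a statement $S$ with $\Gamma\vdash S\triangleright\Delta$ and $[\![S]\!]_\Gamma=(\mathcal C,F)$. -/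

import Mathlib

open scoped ComplexOrder

namespace QLang

noncomputable section

/-! ### Quantum operations between matrix algebras

A finite-dimensional Hilbert space is given by the finite index type of an orthonormal basis. -/

/-- `𝒞 ⊗ ℐ_E` for an auxiliary system `E` of dimension `k`. -/
def ampliate {n m : Type*} (C : Matrix n n ℂ →ₗ[ℂ] Matrix m m ℂ) (k : ℕ)
    (ρ : Matrix (n × Fin k) (n × Fin k) ℂ) : Matrix (m × Fin k) (m × Fin k) ℂ :=
  Matrix.of fun i j => C (Matrix.of fun a b => ρ (a, i.2) (b, j.2)) i.1 j.1

/-- Quantum operations: completely positive, trace non-increasing linear maps. -/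
structure IsQuantumOperation {n m : Type*} [Fintype n] [Fintype m]
    (C : Matrix n n ℂ →ₗ[ℂ] Matrix m m ℂ) : Prop where
  completelyPositive : ∀ (k : ℕ) (ρ : Matrix (n × Fin k) (n × Fin k) ℂ),
    ρ.PosSemidef → (ampliate C k ρ).PosSemidef
  trace_le : ∀ ρ : Matrix n n ℂ, ρ.PosSemidef → (C ρ).trace ≤ ρ.trace

/-- The map `ρ ↦ A ρ B†`. -/
def sandwich {n m : Type*} [Fintype n] [Fintype m] (A B : Matrix m n ℂ) :
    Matrix n n ℂ →ₗ[ℂ] Matrix m m ℂ where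
  toFun ρ := A * ρ * B.conjTranspose
  map_add' ρ σ := by rw [Matrix.mul_add, Matrix.add_mul]
  map_smul' c ρ := by rw [Matrix.mul_smul, Matrix.smul_mul, RingHom.id_apply]

/-- Density matrices: positive semidefinite of trace at most one. -/
def IsDensity {n : Type*} [Fintype n] (ρ : Matrix n n ℂ) : Prop :=
  ρ.PosSemidef ∧ ρ.trace ≤ 1

/-- The Löwner ordering on quantum operations. -/
def LoewnerLE {n m : Type*} [Fintype n] [Fintype m]
    (C D : Matrix n n ℂ →ₗ[ℂ] Matrix m m ℂ) : Prop :=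
  ∀ (k : ℕ) (ρ : Matrix (n × Fin k) (n × Fin k) ℂ), IsDensity ρ →
    (ampliate D k ρ - ampliate C k ρ).PosSemidef

/-! ### Vacuum extensions -/

/-- Pairs `(𝒞, F)` of a linear map on operators and a transformation matrix. -/
abbrev VPair (n m : Type*) : Type _ :=
  (Matrix n n ℂ →ₗ[ℂ] Matrix m m ℂ) × Matrix m n ℂ

/-- The vacuum extension of `(𝒞, F)` acting on `ℋ ⊕ Vac`, with `Vac` spanned by the basis vector
`Sum.inr ()`. In block form it sends `[A, B; C, D]` to `[𝒞 A, F B; C F†, D]`. -/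
def vacExt {n m : Type*} [Fintype n] (p : VPair n m) :
    Matrix (n ⊕ Unit) (n ⊕ Unit) ℂ →ₗ[ℂ] Matrix (m ⊕ Unit) (m ⊕ Unit) ℂ where
  toFun ρ := Matrix.fromBlocks (p.1 ρ.toBlocks₁₁) (p.2 * ρ.toBlocks₁₂)
    (ρ.toBlocks₂₁ * p.2.conjTranspose) ρ.toBlocks₂₂
  map_add' ρ σ := by
    have h₁₁ : (ρ + σ).toBlocks₁₁ = ρ.toBlocks₁₁ + σ.toBlocks₁₁ := rfl
    have h₁₂ : (ρ + σ).toBlocks₁₂ = ρ.toBlocks₁₂ + σ.toBlocks₁₂ := rfl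
    have h₂₁ : (ρ + σ).toBlocks₂₁ = ρ.toBlocks₂₁ + σ.toBlocks₂₁ := rfl
    have h₂₂ : (ρ + σ).toBlocks₂₂ = ρ.toBlocks₂₂ + σ.toBlocks₂₂ := rfl
    rw [h₁₁, h₁₂, h₂₁, h₂₂, Matrix.fromBlocks_add, map_add, Matrix.mul_add, Matrix.add_mul]
  map_smul' c ρ := by
    have h₁₁ : (c • ρ).toBlocks₁₁ = c • ρ.toBlocks₁₁ := rfl
    have h₁₂ : (c • ρ).toBlocks₁₂ = c • ρ.toBlocks₁₂ := rfl
    have h₂₁ : (c • ρ).toBlocks₂₁ = c • ρ.toBlocks₂₁ := rfl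
    have h₂₂ : (c • ρ).toBlocks₂₂ = c • ρ.toBlocks₂₂ := rfl
    rw [h₁₁, h₁₂, h₂₁, h₂₂, RingHom.id_apply, Matrix.fromBlocks_smul, map_smul,
      Matrix.mul_smul, Matrix.smul_mul]

/-- The set `𝒦` of vacuum-extended operations that are trace preserving on the vacuum. -/
def vacOps (n m : Type*) [Fintype n] [Fintype m] : Set (VPair n m) :=
  {p | IsQuantumOperation p.1 ∧ IsQuantumOperation (vacExt p)}

/-- Composition `(𝒟, G) ∘ (𝒞, F) = (𝒟 ∘ 𝒞, G F)`. -/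
def VPair.comp {l m n : Type*} [Fintype m] (q : VPair m l) (p : VPair n m) : VPair n l :=
  (q.1 ∘ₗ p.1, q.2 * p.2)

/-- The ordering on `𝒦`: the Löwner ordering of the vacuum extensions. -/
def VPair.LE {n m : Type*} [Fintype n] [Fintype m] (p q : VPair n m) : Prop :=
  LoewnerLE (vacExt p) (vacExt q)

/-- `p` is the least fixed point of `Φ` in `𝒦`. -/
def IsLeastFixedPoint {n m : Type*} [Fintype n] [Fintype m]
    (Φ : VPair n m → VPair n m) (p : VPair n m) : Prop :=
  (p ∈ vacOps n m ∧ Φ p = p) ∧ ∀ p' ∈ vacOps n m, Φ p' = p' → VPair.LE p p'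

open Classical in
/-- The least fixed point of `Φ` in `𝒦` (and `0` if there is none). -/
def lfp {n m : Type*} [Fintype n] [Fintype m] (Φ : VPair n m → VPair n m) : VPair n m :=
  if h : ∃ p, IsLeastFixedPoint Φ p then h.choose else 0

/-! ### Syntax and well-formedness -/

/-- Statements over a set `X` of qubit variables. -/
inductive Stmt (X : Type*) : Type _
  | skip : Stmt X
  | newQbit (q : X) : Stmt X
  | discard (q : X) : Stmt X
  | gate (q : X) (U : Matrix.unitaryGroup (Fin 2) ℂ) : Stmt X
  | seq (S₀ S₁ : Stmt X) : Stmt X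
  | meas (q : X) (S₀ S₁ : Stmt X) : Stmt X
  | whileDo (q : X) (S : Stmt X) : Stmt X
  | qcase (q : X) (S₀ S₁ : Stmt X) : Stmt X

/-- The variables appearing in a statement. -/
def Stmt.vars {X : Type*} [DecidableEq X] : Stmt X → Finset X
  | .skip => ∅
  | .newQbit q => {q}
  | .discard q => {q}
  | .gate q _ => {q}
  | .seq S₀ S₁ => S₀.vars ∪ S₁.vars
  | .meas q S₀ S₁ => insert q (S₀.vars ∪ S₁.vars)
  | .whileDo q S => insert q S.vars
  | .qcase q S₀ S₁ => insert q (S₀.vars ∪ S₁.vars)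

/-- Derivations of the judgment `Γ ⊢ S ▷ Δ`. An environment is a finite set of variables, and
`insert q Γ` with `q ∉ Γ` is the extension `q, Γ`. -/
inductive Derivation {X : Type*} [DecidableEq X] : Finset X → Stmt X → Finset X → Type _
  | skip (Γ : Finset X) : Derivation Γ .skip Γ
  | newQbit (q : X) (Γ : Finset X) (hq : q ∉ Γ) : Derivation Γ (.newQbit q) (insert q Γ)
  | discard (q : X) (Γ : Finset X) (hq : q ∉ Γ) : Derivation (insert q Γ) (.discard q) Γ
  | gate (q : X) (U : Matrix.unitaryGroup (Fin 2) ℂ) (Γ : Finset X) (hq : q ∈ Γ) :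
      Derivation Γ (.gate q U) Γ
  | seq {Γ Γ' Γ'' : Finset X} {S₀ S₁ : Stmt X} (d₀ : Derivation Γ S₀ Γ')
      (d₁ : Derivation Γ' S₁ Γ'') : Derivation Γ (.seq S₀ S₁) Γ''
  | meas (q : X) {Γ Γ' : Finset X} {S₀ S₁ : Stmt X} (hq : q ∈ Γ) (d₀ : Derivation Γ S₀ Γ')
      (d₁ : Derivation Γ S₁ Γ') : Derivation Γ (.meas q S₀ S₁) Γ'
  | whileDo (q : X) {Γ : Finset X} {S : Stmt X} (hq : q ∈ Γ) (d : Derivation Γ S Γ) :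
      Derivation Γ (.whileDo q S) Γ
  | qcase (q : X) {Γ Γ' : Finset X} {S₀ S₁ : Stmt X} (hq : q ∉ Γ) (hq' : q ∉ Γ')
      (hS : q ∉ S₀.vars ∪ S₁.vars) (d₀ : Derivation Γ S₀ Γ') (d₁ : Derivation Γ S₁ Γ') :
      Derivation (insert q Γ) (.qcase q S₀ S₁) (insert q Γ')

/-- `(Γ; S; Δ)` is a (well-formed) program if `Γ ⊢ S ▷ Δ` is derivable. -/
def IsProgram {X : Type*} [DecidableEq X] (Γ : Finset X) (S : Stmt X) (Δ : Finset X) : Prop :=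
  Nonempty (Derivation Γ S Δ)

/-! ### State spaces and basic operators -/

/-- The computational basis of `ℋ_Γ`: one bit for every variable of `Γ`. -/
abbrev Conf {X : Type*} (Γ : Finset X) : Type _ := {x // x ∈ Γ} → Fin 2

/-- The operator `|k⟩_q ⊗ I_Γ` from `ℋ_Γ` to `ℋ_{q,Γ}`, where `q ∉ Γ`. -/
def ket {X : Type*} [DecidableEq X] (q : X) (Γ : Finset X) (k : Fin 2) :
    Matrix (Conf (insert q Γ)) (Conf Γ) ℂ :=
  fun b a =>
    if b ⟨q, Finset.mem_insert_self q Γ⟩ = k ∧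
        ∀ x : {x // x ∈ Γ}, b ⟨x.1, Finset.mem_insert_of_mem x.2⟩ = a x
    then 1 else 0

/-- The operator `⟨k|_q ⊗ I_Γ` from `ℋ_{q,Γ}` to `ℋ_Γ`, where `q ∉ Γ`. -/
def bra {X : Type*} [DecidableEq X] (q : X) (Γ : Finset X) (k : Fin 2) :
    Matrix (Conf Γ) (Conf (insert q Γ)) ℂ :=
  (ket q Γ k).conjTranspose

/-- The projector `|k⟩⟨k|_q` on `ℋ_Γ`, where `q ∈ Γ`. -/
def proj {X : Type*} [DecidableEq X] {q : X} {Γ : Finset X} (hq : q ∈ Γ) (k : Fin 2) :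
    Matrix (Conf Γ) (Conf Γ) ℂ :=
  Matrix.diagonal fun b => if b ⟨q, hq⟩ = k then 1 else 0

/-- The operator `U_q` on `ℋ_Γ`, where `q ∈ Γ`: `U` on the qubit `q` and the identity elsewhere. -/
def gateAt {X : Type*} [DecidableEq X] {q : X} {Γ : Finset X} (hq : q ∈ Γ)
    (U : Matrix (Fin 2) (Fin 2) ℂ) : Matrix (Conf Γ) (Conf Γ) ℂ :=
  fun b a => if ∀ x : {x // x ∈ Γ}, x.1 ≠ q → b x = a x then U (b ⟨q, hq⟩) (a ⟨q, hq⟩) else 0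

/-! ### Denotational semantics -/

/-- The semantic measurement operation `(𝒞₀ ∘ 𝒫₀ + 𝒞₁ ∘ 𝒫₁, F₀ |0⟩⟨0|_q)`. -/
def measOp {X : Type*} [DecidableEq X] {q : X} {Γ Γ' : Finset X} (hq : q ∈ Γ)
    (p₀ p₁ : VPair (Conf Γ) (Conf Γ')) : VPair (Conf Γ) (Conf Γ') :=
  (p₀.1 ∘ₗ sandwich (proj hq 0) (proj hq 0) + p₁.1 ∘ₗ sandwich (proj hq 1) (proj hq 1),
    p₀.2 * proj hq 0)

/-- The operator `|k⟩⟨k|_q ⊗ F`. -/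
def controlled {X : Type*} [DecidableEq X] (q : X) {Γ Γ' : Finset X} (k : Fin 2)
    (F : Matrix (Conf Γ') (Conf Γ) ℂ) : Matrix (Conf (insert q Γ')) (Conf (insert q Γ)) ℂ :=
  ket q Γ' k * F * bra q Γ k

/-- The semantic quantum case. With the control qubit first, its first component sends
`[A, B; C, D]` to `[𝒞₀ A, F₀ B F₁†; F₁ C F₀†, 𝒞₁ D]`. The composite
`sandwich (ket q Γ' k) (ket q Γ' k) ∘ₗ 𝒞 ∘ₗ sandwich (bra q Γ k) (bra q Γ k)` is `𝒫_k ⊗ 𝒞`. -/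
def qcaseOp {X : Type*} [DecidableEq X] (q : X) {Γ Γ' : Finset X}
    (p₀ p₁ : VPair (Conf Γ) (Conf Γ')) :
    VPair (Conf (insert q Γ)) (Conf (insert q Γ')) :=
  (sandwich (ket q Γ' 0) (ket q Γ' 0) ∘ₗ p₀.1 ∘ₗ sandwich (bra q Γ 0) (bra q Γ 0)
    + sandwich (ket q Γ' 1) (ket q Γ' 1) ∘ₗ p₁.1 ∘ₗ sandwich (bra q Γ 1) (bra q Γ 1)
    + sandwich (controlled q 0 p₀.2) (controlled q 1 p₁.2)
    + sandwich (controlled q 1 p₁.2) (controlled q 0 p₀.2),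
    controlled q 0 p₀.2 + controlled q 1 p₁.2)

/-- The denotational semantics, by recursion on the derivation. -/
def Derivation.sem {X : Type*} [DecidableEq X] {Γ Δ : Finset X} {S : Stmt X} :
    Derivation Γ S Δ → VPair (Conf Γ) (Conf Δ)
  | .skip _ => (LinearMap.id, 1)
  | .newQbit q Γ _ => (sandwich (ket q Γ 0) (ket q Γ 0), ket q Γ 0)
  | .discard q Γ _ =>
      (sandwich (bra q Γ 0) (bra q Γ 0) + sandwich (bra q Γ 1) (bra q Γ 1), bra q Γ 0)
  | .gate _ U _ hq =>
      (sandwich (gateAt hq (U : Matrix (Fin 2) (Fin 2) ℂ))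
        (gateAt hq (U : Matrix (Fin 2) (Fin 2) ℂ)), gateAt hq (U : Matrix (Fin 2) (Fin 2) ℂ))
  | .seq d₀ d₁ => d₁.sem.comp d₀.sem
  | .meas _ hq d₀ d₁ => measOp hq d₀.sem d₁.sem
  | .whileDo _ hq d => lfp fun p => measOp hq (LinearMap.id, 1) (p.comp d.sem)
  | .qcase q _ _ _ d₀ d₁ => qcaseOp q d₀.sem d₁.sem

/-- The interpretation `⟦S⟧_Γ` of a program `(Γ; S; Δ)`. -/
def sem {X : Type*} [DecidableEq X] {Γ Δ : Finset X} {S : Stmt X} (h : IsProgram Γ S Δ) :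
    VPair (Conf Γ) (Conf Δ) :=
  (Classical.choice h).sem

/-! The output environment and the derivation of a program are unique, so that `⟦S⟧_Γ` does not
depend on the choice of a derivation. -/

theorem insert_injective_of_notMem {X : Type*} [DecidableEq X] {q : X} {Γ Γ' : Finset X}
    (h : q ∉ Γ) (h' : q ∉ Γ') (e : insert q Γ = insert q Γ') : Γ = Γ' := by
  rw [← Finset.erase_insert h, e, Finset.erase_insert h']

theorem derivation_unique {X : Type*} [DecidableEq X] {Γ : Finset X} {S : Stmt X}
    {Δ : Finset X} (d : Derivation Γ S Δ) :
    ∀ {Γ₁ Δ₁ : Finset X} (d₁ : Derivation Γ₁ S Δ₁), Γ = Γ₁ → Δ = Δ₁ ∧ HEq d d₁ := by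
  induction d with
  | skip Γ => intro _ _ d₁ e; cases d₁; subst e; exact ⟨rfl, HEq.rfl⟩
  | newQbit q Γ hq => intro _ _ d₁ e; cases d₁; subst e; exact ⟨rfl, HEq.rfl⟩
  | discard q Γ hq =>
    intro _ _ d₁ e
    cases d₁ with
    | discard _ _ hq₁ =>
      obtain rfl := insert_injective_of_notMem hq hq₁ e
      exact ⟨rfl, HEq.rfl⟩
  | gate q U Γ hq => intro _ _ d₁ e; cases d₁; subst e; exact ⟨rfl, HEq.rfl⟩
  | seq a b iha ihb =>
    intro _ _ d₁ e
    cases d₁ with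
    | seq a₁ b₁ =>
      subst e
      obtain ⟨rfl, h⟩ := iha a₁ rfl
      obtain ⟨rfl, h'⟩ := ihb b₁ rfl
      obtain rfl := eq_of_heq h
      obtain rfl := eq_of_heq h'
      exact ⟨rfl, HEq.rfl⟩
  | meas q hq a b iha ihb =>
    intro _ _ d₁ e
    cases d₁ with
    | meas _ hq₁ a₁ b₁ =>
      subst e
      obtain ⟨rfl, h⟩ := iha a₁ rfl
      obtain ⟨_, h'⟩ := ihb b₁ rfl
      obtain rfl := eq_of_heq h
      obtain rfl := eq_of_heq h'
      exact ⟨rfl, HEq.rfl⟩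
  | whileDo q hq a iha =>
    intro _ _ d₁ e
    cases d₁ with
    | whileDo _ hq₁ a₁ =>
      subst e
      obtain ⟨_, h⟩ := iha a₁ rfl
      obtain rfl := eq_of_heq h
      exact ⟨rfl, HEq.rfl⟩
  | qcase q hq hq' hS a b iha ihb =>
    intro _ _ d₁ e
    cases d₁ with
    | qcase _ hq₁ hq₁' hS₁ a₁ b₁ =>
      obtain rfl := insert_injective_of_notMem hq hq₁ e
      obtain ⟨rfl, h⟩ := iha a₁ rfl
      obtain ⟨_, h'⟩ := ihb b₁ rfl
      obtain rfl := eq_of_heq h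
      obtain rfl := eq_of_heq h'
      exact ⟨rfl, HEq.rfl⟩

theorem sem_eq {X : Type*} [DecidableEq X] {Γ Δ : Finset X} {S : Stmt X}
    (h : IsProgram Γ S Δ) (d : Derivation Γ S Δ) : sem h = d.sem := by
  unfold sem
  rw [eq_of_heq (derivation_unique (Classical.choice h) d rfl).2]

end

end QLang

/-! The vacuum block forces `F` to be one of the Kraus operators of `C`. Applied to half of a
maximally entangled vector, the vacuum extension gives a positive matrix with a principal submatrix
`[J, f; f†, 1]`, where `J` is the Choi matrix of `C` and `f` is `F` read as a vector. The Schur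
complement `J - f f†` is positive, so `C = F · F† + ∑ Kᵢ · Kᵢ†` (`vacOps.exists_kraus`), and trace
non-increase becomes `F†F + ∑ Kᵢ†Kᵢ ≤ 1` (`posSemidef_one_sub_of_trace_le`).

Conversely, such a family is realized by a Stinespring dilation. Discarding a qubit has Kraus
operators `⟨0|` and `⟨1|`, of which only `⟨0|` carries vacuum amplitude. Discarding the ancillas of
an isometry therefore leaves its all-zero component as transformation matrix, and `F` is placed
there. The weight missing from `1` goes into extra Kraus operators marked by a flag qubit, which
postselection removes: looping on `skip` diverges on `|1⟩`, so it denotes the projection onto `|0⟩`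
(`isRealizable_kraus_of_posSemidef`).

An isometry between two environments becomes a circuit on a common larger one, by adjoining qubits
in state `|0⟩` and postselecting them away (`isRealizable_pure_isometry`). Circuits come from gates
and quantum cases: complex Householder reflections carry one orthonormal family to another
(`exists_isCircuit_mul_eq`). Equality must be exact, since a global phase is visible relative to the
vacuum. -/

namespace QLang

open Matrix

/-! ### Single Kraus operator maps -/

section Sandwich

variable {l m n : Type*} [Fintype l] [Fintype m] [Fintype n]

theorem sandwich_apply (A B : Matrix m n ℂ) (ρ : Matrix n n ℂ) :
    sandwich A B ρ = A * ρ * Bᴴ := rfl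

theorem sandwich_comp (A B : Matrix l m ℂ) (A' B' : Matrix m n ℂ) :
    sandwich A B ∘ₗ sandwich A' B' = sandwich (A * A') (B * B') := by
  ext1 ρ
  simp only [LinearMap.comp_apply, sandwich_apply, conjTranspose_mul, Matrix.mul_assoc]

theorem sandwich_add_left (A A' B : Matrix m n ℂ) :
    sandwich (A + A') B = sandwich A B + sandwich A' B := by
  ext1 ρ
  simp only [LinearMap.add_apply, sandwich_apply, Matrix.add_mul]

theorem sandwich_add_right (A B B' : Matrix m n ℂ) :
    sandwich A (B + B') = sandwich A B + sandwich A B' := by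
  ext1 ρ
  simp only [LinearMap.add_apply, sandwich_apply, Matrix.mul_add, conjTranspose_add]

theorem sandwich_zero : sandwich (0 : Matrix m n ℂ) 0 = 0 := by
  ext1 ρ
  simp [sandwich_apply]

theorem sandwich_one [DecidableEq n] : sandwich (1 : Matrix n n ℂ) 1 = LinearMap.id := by
  ext1 ρ
  simp [sandwich_apply]

/-- The vacuum-extended operation with the single Kraus operator `M` of vacuum amplitude one. -/
def VPair.pure (M : Matrix m n ℂ) : VPair n m := (sandwich M M, M)

theorem VPair.pure_comp (N : Matrix l m ℂ) (M : Matrix m n ℂ) :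
    (VPair.pure N).comp (VPair.pure M) = VPair.pure (N * M) := by
  simp only [VPair.pure, VPair.comp, sandwich_comp]

end Sandwich

/-! ### Splitting off one qubit -/

section Ket

variable {X : Type*} [DecidableEq X]

/-- The configuration of `insert q Γ` with value `k` at `q` that restricts to `a`. -/
def Conf.cons (q : X) {Γ : Finset X} (k : Fin 2) (a : Conf Γ) : Conf (insert q Γ) :=
  fun x => if h : x.1 ∈ Γ then a ⟨x.1, h⟩ else k

theorem Conf.eq_cons_iff {q : X} {Γ : Finset X} (hq : q ∉ Γ) (k : Fin 2) (a : Conf Γ)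
    (b : Conf (insert q Γ)) :
    (b ⟨q, Finset.mem_insert_self q Γ⟩ = k ∧
      ∀ x : {x // x ∈ Γ}, b ⟨x.1, Finset.mem_insert_of_mem x.2⟩ = a x) ↔
    b = Conf.cons q k a := by
  constructor
  · rintro ⟨h₁, h₂⟩
    funext ⟨x, hx⟩
    by_cases h : x ∈ Γ
    · simpa [Conf.cons, h] using h₂ ⟨x, h⟩
    · obtain rfl : x = q := by simpa [h] using hx
      simpa [Conf.cons, h] using h₁
  · rintro rfl
    exact ⟨by simp [Conf.cons, hq], fun x => by simp [Conf.cons]⟩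

theorem ket_apply {q : X} {Γ : Finset X} (hq : q ∉ Γ) (k : Fin 2) (b : Conf (insert q Γ))
    (a : Conf Γ) : ket q Γ k b a = if b = Conf.cons q k a then 1 else 0 := by
  unfold ket
  exact if_congr (Conf.eq_cons_iff hq k a b) rfl rfl

theorem Conf.cons_inj {q : X} {Γ : Finset X} (hq : q ∉ Γ) {k k' : Fin 2} {a a' : Conf Γ} :
    Conf.cons q k a = Conf.cons q k' a' ↔ k = k' ∧ a = a' := by
  constructor
  · intro h
    obtain ⟨h₁, h₂⟩ := (Conf.eq_cons_iff hq k' a' _).2 h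
    refine ⟨by simpa [Conf.cons, hq] using h₁, funext fun x => ?_⟩
    simpa [Conf.cons] using h₂ x
  · rintro ⟨rfl, rfl⟩; rfl

theorem Conf.exists_eq_cons {q : X} {Γ : Finset X} (hq : q ∉ Γ) (b : Conf (insert q Γ)) :
    ∃ k a, b = Conf.cons q k a :=
  ⟨b ⟨q, Finset.mem_insert_self q Γ⟩, fun x => b ⟨x.1, Finset.mem_insert_of_mem x.2⟩,
    (Conf.eq_cons_iff hq _ _ b).1 ⟨rfl, fun _ => rfl⟩⟩

theorem bra_mul_ket_self {q : X} {Γ : Finset X} (hq : q ∉ Γ) (k : Fin 2) :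
    bra q Γ k * ket q Γ k = 1 := by
  ext a a'
  simp [bra, mul_apply, conjTranspose_apply, ket_apply hq, apply_ite star, Conf.cons_inj hq,
    one_apply, eq_comm]

theorem bra_mul_ket_of_ne {q : X} {Γ : Finset X} (hq : q ∉ Γ) {k k' : Fin 2} (h : k ≠ k') :
    bra q Γ k * ket q Γ k' = 0 := by
  ext a a'
  simp [bra, mul_apply, conjTranspose_apply, ket_apply hq, apply_ite star, Conf.cons_inj hq,
    h.symm]

theorem ket_mul_mul_bra_cons {q : X} {Γ Γ' : Finset X} (hq : q ∉ Γ) (hq' : q ∉ Γ')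
    (k k' l l' : Fin 2) (M : Matrix (Conf Γ') (Conf Γ) ℂ) (a : Conf Γ') (a' : Conf Γ) :
    (ket q Γ' k * M * bra q Γ k') (Conf.cons q l a) (Conf.cons q l' a') =
      if l = k ∧ l' = k' then M a a' else 0 := by
  simp only [bra, mul_apply, conjTranspose_apply, ket_apply hq, ket_apply hq', Conf.cons_inj hq,
    Conf.cons_inj hq', apply_ite star, star_one, star_zero]
  by_cases h : l = k <;> by_cases h' : l' = k' <;> simp [h, h']

theorem ket_mul_bra_cons {q : X} {Γ : Finset X} (hq : q ∉ Γ)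
    (k k' l l' : Fin 2) (a a' : Conf Γ) :
    (ket q Γ k * bra q Γ k') (Conf.cons q l a) (Conf.cons q l' a') =
      if l = k ∧ l' = k' then (1 : Matrix (Conf Γ) (Conf Γ) ℂ) a a' else 0 := by
  rw [← ket_mul_mul_bra_cons hq hq, Matrix.mul_one]

theorem ket_mul_bra_add {q : X} {Γ : Finset X} (hq : q ∉ Γ) :
    ket q Γ 0 * bra q Γ 0 + ket q Γ 1 * bra q Γ 1 = 1 := by
  ext b b'
  obtain ⟨k, a, rfl⟩ := Conf.exists_eq_cons hq b
  obtain ⟨k', a', rfl⟩ := Conf.exists_eq_cons hq b'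
  rw [Matrix.add_apply, ket_mul_bra_cons hq, ket_mul_bra_cons hq]
  fin_cases k <;> fin_cases k' <;> simp [one_apply, Conf.cons_inj hq]

theorem proj_insert {q : X} {Γ : Finset X} (hq : q ∉ Γ) (k : Fin 2) :
    proj (Finset.mem_insert_self q Γ) k = ket q Γ k * bra q Γ k := by
  ext b b'
  obtain ⟨l, a, rfl⟩ := Conf.exists_eq_cons hq b
  obtain ⟨l', a', rfl⟩ := Conf.exists_eq_cons hq b'
  have h : (Conf.cons q l a) ⟨q, Finset.mem_insert_self q Γ⟩ = l := by simp [Conf.cons, hq]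
  rw [ket_mul_bra_cons hq, proj, diagonal_apply, h]
  simp only [Conf.cons_inj hq, one_apply]
  by_cases h₁ : l = k <;> by_cases h₂ : l' = k <;> simp_all
  exact fun e => absurd e.symm h₂

theorem gateAt_insert {q : X} {Γ : Finset X} (hq : q ∉ Γ) (U : Matrix (Fin 2) (Fin 2) ℂ) :
    gateAt (Finset.mem_insert_self q Γ) U = ∑ k, ∑ l, U k l • (ket q Γ k * bra q Γ l) := by
  ext b b'
  obtain ⟨l, a, rfl⟩ := Conf.exists_eq_cons hq b
  obtain ⟨l', a', rfl⟩ := Conf.exists_eq_cons hq b'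
  have h (l : Fin 2) (a : Conf Γ) :
      (Conf.cons q l a) ⟨q, Finset.mem_insert_self q Γ⟩ = l := by simp [Conf.cons, hq]
  have h' : (∀ x : {x // x ∈ insert q Γ}, x.1 ≠ q →
      Conf.cons q l a x = Conf.cons q l' a' x) ↔ a = a' := by
    constructor
    · intro H
      funext x
      simpa [Conf.cons] using H ⟨x.1, Finset.mem_insert_of_mem x.2⟩
        (fun e => hq (e ▸ x.2))
    · rintro rfl ⟨x, hx⟩ hxq
      have : x ∈ Γ := by simpa [hxq] using hx
      simp [Conf.cons, this]
  simp only [gateAt, h, h', Matrix.sum_apply, Matrix.smul_apply, ket_mul_bra_cons hq, one_apply]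
  fin_cases l <;> fin_cases l' <;> simp

theorem gateAt_mul_ket {q : X} {Γ : Finset X} (hq : q ∉ Γ) (U : Matrix (Fin 2) (Fin 2) ℂ)
    (k : Fin 2) :
    gateAt (Finset.mem_insert_self q Γ) U * ket q Γ k = U 0 k • ket q Γ 0 + U 1 k • ket q Γ 1 := by
  rw [gateAt_insert hq]
  fin_cases k <;>
  simp [Matrix.add_mul, Matrix.mul_assoc, bra_mul_ket_self hq, bra_mul_ket_of_ne hq]

theorem gateAt_conjTranspose {q : X} {Γ : Finset X} (hq : q ∈ Γ)
    (U : Matrix (Fin 2) (Fin 2) ℂ) : (gateAt hq U)ᴴ = gateAt hq Uᴴ := by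
  ext b b'
  simp only [gateAt, conjTranspose_apply, apply_ite star, star_zero]
  exact if_congr (forall_congr' fun x => by rw [eq_comm]) rfl rfl

theorem controlled_conjTranspose (q : X) {Γ Γ' : Finset X} (k : Fin 2)
    (M : Matrix (Conf Γ') (Conf Γ) ℂ) : (controlled q k M)ᴴ = controlled q k Mᴴ := by
  simp only [controlled, bra, conjTranspose_mul, conjTranspose_conjTranspose, Matrix.mul_assoc]

/-- The interference terms in the quantum case are exactly the cross terms of `(M₀ ⊕ M₁) ρ (M₀ ⊕
M₁)†`, so pure branches stay pure. -/
theorem qcaseOp_pure (q : X) {Γ Γ' : Finset X} (M₀ M₁ : Matrix (Conf Γ') (Conf Γ) ℂ) :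
    qcaseOp q (VPair.pure M₀) (VPair.pure M₁) =
      VPair.pure (controlled q 0 M₀ + controlled q 1 M₁) := by
  simp only [qcaseOp, VPair.pure, sandwich_comp, sandwich_add_left, sandwich_add_right,
    controlled, ← Matrix.mul_assoc]
  congr 1
  abel

end Ket

/-! ### Complete positivity and antisymmetry of the Löwner order -/

section CompletelyPositive

variable {l m n : Type*}

theorem posSemidef_ampliate_sandwich [Fintype m] [Fintype n] (A : Matrix m n ℂ) (k : ℕ)
    {ρ : Matrix (n × Fin k) (n × Fin k) ℂ} (hρ : ρ.PosSemidef) :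
    (ampliate (sandwich A A) k ρ).PosSemidef := by
  have h := hρ.mul_mul_conjTranspose_same (kroneckerMap (· * ·) A (1 : Matrix (Fin k) (Fin k) ℂ))
  convert h using 1
  ext ⟨i, x⟩ ⟨j, y⟩
  simp only [ampliate, sandwich_apply, of_apply, mul_apply, conjTranspose_apply,
    kroneckerMap_apply, Fintype.sum_prod_type, one_apply, mul_ite, ite_mul, mul_one, mul_zero,
    zero_mul, Finset.sum_ite_eq, Finset.mem_univ, if_true, star_zero, apply_ite star]

theorem ampliate_comp (D : Matrix m m ℂ →ₗ[ℂ] Matrix l l ℂ) (C : Matrix n n ℂ →ₗ[ℂ] Matrix m m ℂ)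
    (k : ℕ) (ρ : Matrix (n × Fin k) (n × Fin k) ℂ) :
    ampliate (D ∘ₗ C) k ρ = ampliate D k (ampliate C k ρ) := rfl

theorem ampliate_sub (C D : Matrix n n ℂ →ₗ[ℂ] Matrix m m ℂ)
    (k : ℕ) (ρ : Matrix (n × Fin k) (n × Fin k) ℂ) :
    ampliate (D - C) k ρ = ampliate D k ρ - ampliate C k ρ := rfl

/-- Polarization: the vectors `u + v` and `u + i v` recover the value at `u v†`, and matrix units
have this form. -/
theorem linearMap_eq_zero_of_rankOne [Fintype n] [DecidableEq n]
    {L : Matrix n n ℂ →ₗ[ℂ] Matrix m m ℂ}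
    (h : ∀ v : n → ℂ, L (vecMulVec v (star v)) = 0) : L = 0 := by
  have key (u v : n → ℂ) : L (vecMulVec u (star v)) = 0 := by
    have h₁ := h (u + v)
    have h₂ := h (u + Complex.I • v)
    simp only [star_add, star_smul, add_vecMulVec, vecMulVec_add, smul_vecMulVec, vecMulVec_smul,
      map_add, map_smul, h, smul_zero, zero_add, add_zero, Complex.star_def, Complex.conj_I]
      at h₁ h₂
    have h₃ : (2 : ℂ) • L (vecMulVec u (star v)) =
        (L (vecMulVec v (star u)) + L (vecMulVec u (star v))) +
          Complex.I • (Complex.I • L (vecMulVec v (star u)) +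
            (-Complex.I) • L (vecMulVec u (star v))) := by
      rw [smul_add, smul_smul, smul_smul, mul_neg, Complex.I_mul_I]
      module
    have h₄ : L (vecMulVec v (star u)) + L (vecMulVec u (star v)) = 0 := by
      rw [← h₁]
    have h₅ : Complex.I • L (vecMulVec v (star u)) +
        (-Complex.I) • L (vecMulVec u (star v)) = 0 := by
      rw [← h₂]
    rw [h₄, h₅, smul_zero, add_zero] at h₃
    exact (smul_eq_zero.1 h₃).resolve_left two_ne_zero
  refine LinearMap.ext fun ρ => ?_
  rw [matrix_eq_sum_single ρ, LinearMap.zero_apply]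
  simp only [map_sum]
  refine Finset.sum_eq_zero fun i _ => Finset.sum_eq_zero fun j _ => ?_
  have : single i j (ρ i j) = vecMulVec (Pi.single i (ρ i j)) (star (Pi.single j (1 : ℂ))) := by
    ext a b
    by_cases ha : i = a <;> by_cases hb : j = b <;>
      simp [vecMulVec_apply, ha, hb, eq_comm]
  rw [this, key]

/-- Needed because the least fixed point is a chosen one: antisymmetry makes it unique. -/
theorem LoewnerLE.antisymm [Fintype m] [Fintype n] [DecidableEq n]
    {C D : Matrix n n ℂ →ₗ[ℂ] Matrix m m ℂ} (h₁ : LoewnerLE C D) (h₂ : LoewnerLE D C) : C = D := by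
  rw [← sub_eq_zero]
  refine linearMap_eq_zero_of_rankOne fun v => ?_
  have hV : (vecMulVec v (star v)).PosSemidef := posSemidef_vecMulVec_self_star v
  set t : ℝ := ∑ i, ‖v i‖ ^ 2 with ht
  have htr : (vecMulVec v (star v)).trace = (t : ℂ) := by
    simp [trace, vecMulVec_apply, ht, Complex.mul_conj, Complex.normSq_eq_norm_sq]
  have ht0 : 0 ≤ t := Finset.sum_nonneg fun i _ => by positivity
  -- The order only tests matrices of trace at most one. Dividing by `1 + ‖v‖²` achieves this, also
  -- for `v = 0`.
  set ρ : Matrix n n ℂ := ((1 + t : ℝ)⁻¹ : ℂ) • vecMulVec v (star v) with hρ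
  have hpos : ρ.PosSemidef := by
    refine hV.smul ?_
    rw [← Complex.ofReal_inv]
    exact_mod_cast (by positivity : (0 : ℝ) ≤ (1 + t)⁻¹)
  have htr' : ρ.trace ≤ 1 := by
    rw [hρ, trace_smul, htr, smul_eq_mul, ← Complex.ofReal_inv, ← Complex.ofReal_mul]
    have : (1 + t)⁻¹ * t ≤ 1 := by
      rw [inv_mul_le_iff₀ (by positivity)]; linarith
    exact_mod_cast this
  have hd : IsDensity (ρ.submatrix Prod.fst Prod.fst : Matrix (n × Fin 1) (n × Fin 1) ℂ) := by
    refine ⟨hpos.submatrix _, ?_⟩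
    convert htr' using 1
    simp [trace, Fintype.sum_prod_type]
  have e₁ := (h₁ 1 _ hd).submatrix fun i : m => (i, (0 : Fin 1))
  have e₂ := (h₂ 1 _ hd).submatrix fun i : m => (i, (0 : Fin 1))
  have e₃ : (D ρ - C ρ).PosSemidef := e₁
  have e₄ : (C ρ - D ρ).PosSemidef := e₂
  have e₅ : (C - D) ρ = 0 := by
    open scoped MatrixOrder in
    exact le_antisymm
      (by rw [← sub_nonneg, zero_sub, LinearMap.sub_apply, neg_sub]; exact e₃.nonneg) e₄.nonneg
  rw [hρ, map_smul] at e₅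
  refine (smul_eq_zero.1 e₅).resolve_left (inv_ne_zero ?_)
  exact_mod_cast (by positivity : (1 + t : ℝ) ≠ 0)

theorem isQuantumOperation_sandwich_diagonal [Fintype n] [DecidableEq n] {d : n → ℂ}
    (hd : ∀ i, d i = 0 ∨ d i = 1) : IsQuantumOperation (sandwich (diagonal d) (diagonal d)) := by
  refine ⟨fun k ρ hρ => posSemidef_ampliate_sandwich _ k hρ, fun ρ hρ => ?_⟩
  refine Finset.sum_le_sum fun i _ => ?_
  have : 0 ≤ ρ i i := hρ.diag_nonneg
  simp only [diag_apply, sandwich_apply, diagonal_conjTranspose, mul_diagonal, diagonal_mul]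
  rcases hd i with h | h <;> simp [h, this]

theorem vacExt_pure [Fintype m] [Fintype n] (M : Matrix m n ℂ) :
    vacExt (VPair.pure M) = sandwich (fromBlocks M 0 0 1) (fromBlocks M 0 0 1) := by
  ext1 ρ
  rw [sandwich_apply]
  nth_rw 2 [← fromBlocks_toBlocks ρ]
  simp [fromBlocks_conjTranspose, fromBlocks_multiply, vacExt, VPair.pure, sandwich_apply]

end CompletelyPositive

/-! ### The loop with empty body -/

section While

variable {X : Type*} [DecidableEq X]

theorem pure_proj_mem_vacOps {q : X} {Γ : Finset X} (hq : q ∈ Γ) (k : Fin 2) :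
    VPair.pure (proj hq k) ∈ vacOps (Conf Γ) (Conf Γ) := by
  have h (b : Conf Γ) : (if b ⟨q, hq⟩ = k then (1 : ℂ) else 0) = 0 ∨
      (if b ⟨q, hq⟩ = k then (1 : ℂ) else 0) = 1 := by
    split_ifs <;> simp
  refine ⟨isQuantumOperation_sandwich_diagonal h, ?_⟩
  rw [vacExt_pure]
  unfold proj
  rw [← diagonal_one, fromBlocks_diagonal]
  exact isQuantumOperation_sandwich_diagonal (Sum.rec h fun _ => Or.inr rfl)

theorem proj_mul_proj_of_ne {q : X} {Γ : Finset X} (hq : q ∈ Γ) {k k' : Fin 2} (h : k ≠ k') :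
    proj hq k * proj hq k' = 0 := by
  simp only [proj, diagonal_mul_diagonal, diagonal_eq_zero]
  funext b
  by_cases h' : b ⟨q, hq⟩ = k <;> simp [h', h]

theorem measOp_id_self {q : X} {Γ : Finset X} (hq : q ∈ Γ) (p : VPair (Conf Γ) (Conf Γ)) :
    measOp hq (LinearMap.id, 1) (p.comp (LinearMap.id, 1)) =
      (sandwich (proj hq 0) (proj hq 0) + p.1 ∘ₗ sandwich (proj hq 1) (proj hq 1), proj hq 0) := by
  simp [measOp, VPair.comp]

/-- The inclusion of `ℋ` into `ℋ ⊕ Vac`. -/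
noncomputable def vacInl (n : Type*) [DecidableEq n] : Matrix (n ⊕ Unit) n ℂ :=
  fun i j => if i = Sum.inl j then 1 else 0

theorem conjTranspose_vacInl_mul_mul_vacInl {n : Type*} [Fintype n] [DecidableEq n]
    (ρ : Matrix (n ⊕ Unit) (n ⊕ Unit) ℂ) : (vacInl n)ᴴ * ρ * vacInl n = ρ.toBlocks₁₁ := by
  ext i j
  simp [mul_apply, vacInl, toBlocks₁₁, apply_ite star]

theorem vacInl_mul_mul_conjTranspose_vacInl {n : Type*} [Fintype n] [DecidableEq n]
    (ρ : Matrix n n ℂ) : vacInl n * ρ * (vacInl n)ᴴ = fromBlocks ρ 0 0 0 := by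
  ext (i | i) (j | j) <;> simp [mul_apply, vacInl, apply_ite star]

/-- Any fixed point `p` has `p.2 = |0⟩⟨0|` and `p.1 = 𝒫₀ + p.1 ∘ 𝒫₁`. It thus exceeds the projection
by `p.1 ∘ 𝒫₁`, which is completely positive, and all vacuum blocks cancel. -/
theorem isLeastFixedPoint_pure_proj {q : X} {Γ : Finset X} (hq : q ∈ Γ) :
    IsLeastFixedPoint (fun p : VPair (Conf Γ) (Conf Γ) =>
      measOp hq (LinearMap.id, 1) (p.comp (LinearMap.id, 1))) (VPair.pure (proj hq 0)) := by
  refine ⟨⟨pure_proj_mem_vacOps hq 0, ?_⟩, fun p hp h => ?_⟩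
  · simp only [measOp_id_self]
    simp [VPair.pure, sandwich_comp, proj_mul_proj_of_ne, sandwich_zero]
  · simp only [measOp_id_self] at h
    intro k ρ hρ
    rw [← ampliate_sub]
    have key : vacExt p - vacExt (VPair.pure (proj hq 0)) =
        sandwich (vacInl (Conf Γ)) (vacInl (Conf Γ)) ∘ₗ p.1 ∘ₗ
          sandwich (proj hq 1 * (vacInl (Conf Γ))ᴴ) (proj hq 1 * (vacInl (Conf Γ))ᴴ) := by
      refine LinearMap.ext fun ρ => ?_
      have h₁ : p.1 ρ.toBlocks₁₁ = proj hq 0 * ρ.toBlocks₁₁ * (proj hq 0)ᴴ +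
          p.1 (proj hq 1 * ρ.toBlocks₁₁ * (proj hq 1)ᴴ) := by
        conv_lhs => rw [← h]
        rfl
      have h₂ : p.2 = proj hq 0 := by rw [← h]
      have h₃ : proj hq 1 * (vacInl (Conf Γ))ᴴ * ρ * (proj hq 1 * (vacInl (Conf Γ))ᴴ)ᴴ =
          proj hq 1 * ρ.toBlocks₁₁ * (proj hq 1)ᴴ := by
        rw [← conjTranspose_vacInl_mul_mul_vacInl]
        simp only [conjTranspose_mul, conjTranspose_conjTranspose, Matrix.mul_assoc]
      rw [LinearMap.sub_apply, LinearMap.comp_apply, LinearMap.comp_apply, sandwich_apply,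
        sandwich_apply, h₃, vacInl_mul_mul_conjTranspose_vacInl]
      simp only [vacExt, LinearMap.coe_mk, AddHom.coe_mk, VPair.pure, h₁, h₂, sandwich_apply]
      ext (i | i) (j | j) <;> simp
    rw [key, ampliate_comp, ampliate_comp]
    exact posSemidef_ampliate_sandwich _ _
      (hp.1.completelyPositive _ _ (posSemidef_ampliate_sandwich _ _ hρ.1))

theorem IsLeastFixedPoint.lfp_eq {n m : Type*} [Fintype n] [Fintype m] [DecidableEq n]
    {Φ : VPair n m → VPair n m} {p : VPair n m} (h : IsLeastFixedPoint Φ p) : lfp Φ = p := by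
  have hex : ∃ p, IsLeastFixedPoint Φ p := ⟨p, h⟩
  rw [lfp, dif_pos hex]
  have h' := hex.choose_spec
  set p' := hex.choose
  have e := LoewnerLE.antisymm (h.2 p' h'.1.1 h'.1.2) (h'.2 p h.1.1 h.1.2)
  refine Prod.ext ?_ ?_
  · ext1 ρ
    have := congrArg toBlocks₁₁ (LinearMap.congr_fun e (fromBlocks ρ 0 0 0))
    simpa [vacExt] using this.symm
  · ext i j
    have := congrArg toBlocks₁₂ (LinearMap.congr_fun e (fromBlocks 0 (single j () 1) 0 0))
    have := congrFun (congrFun this i) ()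
    simpa [vacExt, mul_apply, single_apply] using this.symm

end While

/-! ### Synthesis of unitary circuits -/

section UnitarySynthesis

variable {X : Type*} [DecidableEq X]

theorem ext_mul_ket {n : Type*} {q : X} {Γ : Finset X} (hq : q ∉ Γ)
    {A B : Matrix n (Conf (insert q Γ)) ℂ} (h₀ : A * ket q Γ 0 = B * ket q Γ 0)
    (h₁ : A * ket q Γ 1 = B * ket q Γ 1) : A = B := by
  rw [← Matrix.mul_one A, ← Matrix.mul_one B, ← ket_mul_bra_add hq]
  simp only [Matrix.mul_add, ← Matrix.mul_assoc, h₀, h₁]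

theorem gateAt_mul_gateAt {q : X} {Γ : Finset X} (hq : q ∉ Γ) (U V : Matrix (Fin 2) (Fin 2) ℂ) :
    gateAt (Finset.mem_insert_self q Γ) U * gateAt (Finset.mem_insert_self q Γ) V =
      gateAt (Finset.mem_insert_self q Γ) (U * V) := by
  refine ext_mul_ket hq ?_ ?_ <;>
  · simp only [Matrix.mul_assoc, gateAt_mul_ket hq, Matrix.mul_add, Matrix.mul_smul, mul_apply,
      Fin.sum_univ_two, smul_add, smul_smul]
    module

theorem gateAt_one {q : X} {Γ : Finset X} (hq : q ∈ Γ) : gateAt hq 1 = 1 := by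
  ext b b'
  simp only [gateAt, one_apply]
  rw [← ite_and]
  refine if_congr ⟨fun h => funext fun x => ?_, fun h => ?_⟩ rfl rfl
  · by_cases hx : x.1 = q
    · obtain rfl : x = ⟨q, hq⟩ := Subtype.ext hx
      exact h.2
    · exact h.1 x hx
  · subst h
    exact ⟨fun _ _ => rfl, rfl⟩

theorem controlled_add_mul_ket_zero {q : X} {Γ Γ' : Finset X} (hq : q ∉ Γ)
    (M N : Matrix (Conf Γ') (Conf Γ) ℂ) :
    (controlled q 0 M + controlled q 1 N) * ket q Γ 0 = ket q Γ' 0 * M := by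
  simp [controlled, Matrix.add_mul, Matrix.mul_assoc, bra_mul_ket_self hq, bra_mul_ket_of_ne hq]

theorem controlled_add_mul_ket_one {q : X} {Γ Γ' : Finset X} (hq : q ∉ Γ)
    (M N : Matrix (Conf Γ') (Conf Γ) ℂ) :
    (controlled q 0 M + controlled q 1 N) * ket q Γ 1 = ket q Γ' 1 * N := by
  simp [controlled, Matrix.add_mul, Matrix.mul_assoc, bra_mul_ket_self hq, bra_mul_ket_of_ne hq]

/-- `M` is the transformation of a program on `Γ` that uses only variables of `Γ` and has a single
Kraus operator. -/
def IsCircuit (Γ : Finset X) (M : Matrix (Conf Γ) (Conf Γ) ℂ) : Prop :=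
  ∃ S, S.vars ⊆ Γ ∧ ∃ d : Derivation Γ S Γ, d.sem = VPair.pure M

theorem isCircuit_one (Γ : Finset X) : IsCircuit Γ 1 :=
  ⟨.skip, by simp [Stmt.vars], .skip Γ, by simp [Derivation.sem, VPair.pure, sandwich_one]⟩

theorem IsCircuit.mul {Γ : Finset X} {M N : Matrix (Conf Γ) (Conf Γ) ℂ} (hM : IsCircuit Γ M)
    (hN : IsCircuit Γ N) : IsCircuit Γ (M * N) := by
  obtain ⟨S, hS, d, hd⟩ := hM
  obtain ⟨T, hT, e, he⟩ := hN
  exact ⟨.seq T S, Finset.union_subset hT hS, .seq e d, by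
    rw [Derivation.sem, hd, he, VPair.pure_comp]⟩

theorem isCircuit_gateAt {q : X} {Γ : Finset X} (hq : q ∈ Γ) {U : Matrix (Fin 2) (Fin 2) ℂ}
    (hU : U ∈ unitaryGroup (Fin 2) ℂ) : IsCircuit Γ (gateAt hq U) :=
  ⟨.gate q ⟨U, hU⟩, by simpa [Stmt.vars] using hq, .gate q ⟨U, hU⟩ Γ hq, rfl⟩

/-- The bound on the variables in `IsCircuit` is what makes the control qubit absent from both
branches. -/
theorem IsCircuit.controlled_add {q : X} {Γ : Finset X} (hq : q ∉ Γ)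
    {M N : Matrix (Conf Γ) (Conf Γ) ℂ} (hM : IsCircuit Γ M) (hN : IsCircuit Γ N) :
    IsCircuit (insert q Γ) (controlled q 0 M + controlled q 1 N) := by
  obtain ⟨S, hS, d, hd⟩ := hM
  obtain ⟨T, hT, e, he⟩ := hN
  have h := Finset.union_subset hS hT
  exact ⟨.qcase q S T, Finset.insert_subset_insert q h, .qcase q hq hq (fun H => hq (h H)) d e, by
    rw [Derivation.sem, hd, he, qcaseOp_pure]⟩

/-- The basis vector of the configuration `0`. -/
noncomputable def zeroVec (Γ : Finset X) : Conf Γ → ℂ := Pi.single 0 1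

theorem ket_mulVec_zeroVec {q : X} {Γ : Finset X} (hq : q ∉ Γ) :
    ket q Γ 0 *ᵥ zeroVec Γ = zeroVec (insert q Γ) := by
  have h : Conf.cons q 0 (0 : Conf Γ) = 0 := by
    funext x; simp [Conf.cons]
  ext b
  simp [zeroVec, ket_apply hq, h, Pi.single_apply]

/-- The gate multiplying the basis vector of the configuration `0` by `z`. -/
noncomputable def phaseGate (Γ : Finset X) (z : ℂ) : Matrix (Conf Γ) (Conf Γ) ℂ :=
  1 - (1 - z) • vecMulVec (zeroVec Γ) (star (zeroVec Γ))

theorem phaseGate_insert {q : X} {Γ : Finset X} (hq : q ∉ Γ) (z : ℂ) :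
    phaseGate (insert q Γ) z = controlled q 0 (phaseGate Γ z) + controlled q 1 1 := by
  have h : vecMulVec (zeroVec (insert q Γ)) (star (zeroVec (insert q Γ))) =
      ket q Γ 0 * vecMulVec (zeroVec Γ) (star (zeroVec Γ)) * bra q Γ 0 := by
    rw [← ket_mulVec_zeroVec hq, bra, mul_vecMulVec, vecMulVec_mul, star_mulVec]
  simp only [phaseGate, controlled, Matrix.mul_sub, Matrix.sub_mul, Matrix.mul_one, h,
    Matrix.mul_smul, Matrix.smul_mul]
  rw [← ket_mul_bra_add hq]
  abel

theorem phaseGate_insert_eq_gateAt {q : X} {Γ : Finset X} (hq : q ∉ Γ) {z : ℂ}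
    (h : phaseGate Γ z = z • 1) :
    phaseGate (insert q Γ) z = gateAt (Finset.mem_insert_self q Γ) !![z, 0; 0, 1] := by
  rw [phaseGate_insert hq, h]
  refine ext_mul_ket hq ?_ ?_
  · rw [controlled_add_mul_ket_zero hq, gateAt_mul_ket hq, Matrix.mul_smul, Matrix.mul_one]
    simp
  · rw [controlled_add_mul_ket_one hq, gateAt_mul_ket hq, Matrix.mul_one]
    simp

/-- A multiply controlled phase, by nested quantum cases down to the one-qubit gate `diag(z, 1)`. On
the empty environment it would be a bare scalar, for which no gate is available. -/
theorem isCircuit_phaseGate {z : ℂ} (hz : z * star z = 1) {Γ : Finset X} (hΓ : Γ.Nonempty) :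
    IsCircuit Γ (phaseGate Γ z) := by
  induction Γ using Finset.induction_on with
  | empty => exact absurd hΓ (by simp)
  | insert q Γ hq ih =>
    rcases Γ.eq_empty_or_nonempty with rfl | hΓ'
    · have hU : !![z, 0; 0, 1] ∈ unitaryGroup (Fin 2) ℂ := by
        rw [mem_unitaryGroup_iff]
        ext i j
        fin_cases i <;> fin_cases j <;> simp [mul_apply, star_apply]
        simpa using hz
      have h : phaseGate (∅ : Finset X) z = z • 1 := by
        ext i j
        obtain rfl : i = 0 := Subsingleton.elim _ _
        obtain rfl : j = 0 := Subsingleton.elim _ _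
        simp [phaseGate, zeroVec, vecMulVec_apply]
      have e := phaseGate_insert_eq_gateAt hq h
      exact e ▸ isCircuit_gateAt _ hU
    · rw [phaseGate_insert hq]
      exact (ih hΓ').controlled_add hq (isCircuit_one Γ)

theorem exists_unitary_mulVec_fin_two (v : Fin 2 → ℂ) :
    ∃ U ∈ unitaryGroup (Fin 2) ℂ, (U *ᵥ v) 1 = 0 := by
  by_cases hv : v = 0
  · exact ⟨1, one_mem _, by simp [hv]⟩
  set r : ℝ := ‖v 0‖ ^ 2 + ‖v 1‖ ^ 2 with hr
  have hr0 : 0 < r := by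
    by_contra! h
    refine hv (funext fun i => ?_)
    have h₀ : ‖v 0‖ = 0 := by nlinarith [norm_nonneg (v 0), norm_nonneg (v 1)]
    have h₁ : ‖v 1‖ = 0 := by nlinarith [norm_nonneg (v 0), norm_nonneg (v 1)]
    fin_cases i
    · simpa using h₀
    · simpa using h₁
  have hs : ((Real.sqrt r : ℝ) : ℂ) * (Real.sqrt r : ℝ) = r := by
    rw [← Complex.ofReal_mul, Real.mul_self_sqrt hr0.le]
  have hs0 : ((Real.sqrt r : ℝ) : ℂ) ≠ 0 := by
    exact_mod_cast (Real.sqrt_pos.2 hr0).ne'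
  have hrv : (r : ℂ) = v 0 * star (v 0) + v 1 * star (v 1) := by
    simp [hr, Complex.mul_conj, Complex.normSq_eq_norm_sq]
  set s : ℂ := ((Real.sqrt r : ℝ) : ℂ)
  have hss : star s = s := Complex.conj_ofReal _
  refine ⟨s⁻¹ • !![star (v 0), star (v 1); -v 1, v 0], ?_, ?_⟩
  · rw [mem_unitaryGroup_iff, star_smul, star_inv₀, hss, smul_mul_smul_comm, ← mul_inv, hs, hrv]
    have : v 0 * star (v 0) + v 1 * star (v 1) ≠ 0 := by
      rw [← hrv]; exact_mod_cast hr0.ne'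
    rw [inv_smul_eq_iff₀ this]
    ext i j
    fin_cases i <;> fin_cases j <;> simp [mul_apply, star_apply] <;> ring
  · simp [mulVec, dotProduct]
    ring

/-- Recursive state preparation, reversed: a quantum case on `q` reduces both halves of `v` to
multiples `c₀`, `c₁` of the zero vector, and one gate on `q` then rotates `(c₀, c₁)` onto `|0⟩`. The
adjoint is carried through the induction because `IsCircuit` does not include unitarity. -/
theorem exists_isCircuit_mulVec_eq_smul_zeroVec {Γ : Finset X} (v : Conf Γ → ℂ) :
    ∃ P, IsCircuit Γ P ∧ IsCircuit Γ Pᴴ ∧ Pᴴ * P = 1 ∧ ∃ c : ℂ, P *ᵥ v = c • zeroVec Γ := by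
  induction Γ using Finset.induction_on with
  | empty =>
    refine ⟨1, isCircuit_one _, by simpa using isCircuit_one _, by simp, v 0, ?_⟩
    ext i
    obtain rfl : i = 0 := Subsingleton.elim _ _
    simp [zeroVec]
  | insert q Γ hq ih =>
    obtain ⟨P₀, h₀, h₀', h₀'', c₀, hc₀⟩ := ih (bra q Γ 0 *ᵥ v)
    obtain ⟨P₁, h₁, h₁', h₁'', c₁, hc₁⟩ := ih (bra q Γ 1 *ᵥ v)
    obtain ⟨U, hU, hUc⟩ := exists_unitary_mulVec_fin_two ![c₀, c₁]
    set G := gateAt (Finset.mem_insert_self q Γ) U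
    set Q := controlled q 0 P₀ + controlled q 1 P₁ with hQ
    have hG : Gᴴ * G = 1 := by
      rw [gateAt_conjTranspose, gateAt_mul_gateAt hq, ← star_eq_conjTranspose,
        mem_unitaryGroup_iff'.1 hU, gateAt_one]
    have hQQ : Qᴴ * Q = 1 := by
      rw [hQ, conjTranspose_add, controlled_conjTranspose, controlled_conjTranspose]
      refine ext_mul_ket hq ?_ ?_
      · rw [Matrix.mul_assoc, controlled_add_mul_ket_zero hq, ← Matrix.mul_assoc,
          controlled_add_mul_ket_zero hq, Matrix.mul_assoc, h₀'', Matrix.mul_one, Matrix.one_mul]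
      · rw [Matrix.mul_assoc, controlled_add_mul_ket_one hq, ← Matrix.mul_assoc,
          controlled_add_mul_ket_one hq, Matrix.mul_assoc, h₁'', Matrix.mul_one, Matrix.one_mul]
    refine ⟨G * Q, (isCircuit_gateAt _ hU).mul (h₀.controlled_add hq h₁), ?_, ?_,
      U 0 0 * c₀ + U 0 1 * c₁, ?_⟩
    · rw [conjTranspose_mul, hQ, conjTranspose_add, controlled_conjTranspose,
        controlled_conjTranspose, gateAt_conjTranspose]
      exact (h₀'.controlled_add hq h₁').mul (isCircuit_gateAt _ (Unitary.star_mem hU))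
    · rw [conjTranspose_mul, Matrix.mul_assoc, ← Matrix.mul_assoc Gᴴ, hG, Matrix.one_mul, hQQ]
    · have hUc' : U 1 0 * c₀ + U 1 1 * c₁ = 0 := by
        simpa [mulVec, dotProduct] using hUc
      have e : Q *ᵥ v = c₀ • (ket q Γ 0 *ᵥ zeroVec Γ) + c₁ • (ket q Γ 1 *ᵥ zeroVec Γ) := by
        simp only [hQ, controlled, add_mulVec, ← mulVec_mulVec, hc₀, hc₁, mulVec_smul]
      rw [← mulVec_mulVec, e, mulVec_add, mulVec_smul, mulVec_smul, mulVec_mulVec, mulVec_mulVec,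
        gateAt_mul_ket hq, gateAt_mul_ket hq, ← ket_mulVec_zeroVec hq]
      simp only [add_mulVec, smul_mulVec, smul_add, smul_smul]
      have : c₀ * U 1 0 = - (c₁ * U 1 1) := by linear_combination hUc'
      rw [this]
      module

/-- A unit vector can be mapped to any other by a circuit that is unitary and fixes every vector
orthogonal to both. -/
theorem exists_isCircuit_mulVec_eq {Γ : Finset X} (hΓ : Γ.Nonempty) {u v : Conf Γ → ℂ}
    (hu : star u ⬝ᵥ u = 1) (hv : star v ⬝ᵥ v = 1) :
    ∃ R, IsCircuit Γ R ∧ Rᴴ * R = 1 ∧ R *ᵥ u = v ∧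
      ∀ x, star u ⬝ᵥ x = 0 → star v ⬝ᵥ x = 0 → R *ᵥ x = x := by
  by_cases huv : u = v
  · exact ⟨1, isCircuit_one Γ, by simp, by simpa using huv, fun x _ _ => by simp⟩
  -- Complex Householder map `R = 1 - (1 - t)⁻¹ w w†` with `t = ⟨v, u⟩`. Since `⟨w, u⟩ = 1 - t`, it
  -- sends `u` to `u - w = v`.
  set w := u - v with hw
  obtain ⟨P, hP, hP', hPP, c, hc⟩ := exists_isCircuit_mulVec_eq_smul_zeroVec w
  have hPP' : P * Pᴴ = 1 := mul_eq_one_comm.1 hPP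
  have hz : star (zeroVec Γ) ⬝ᵥ zeroVec Γ = 1 := by simp [zeroVec, dotProduct, Pi.single_apply]
  have hwc : star w ⬝ᵥ w = star c * c := by
    have : star (P *ᵥ w) ⬝ᵥ (P *ᵥ w) = star w ⬝ᵥ w := by
      rw [star_mulVec, ← dotProduct_mulVec, mulVec_mulVec, hPP, one_mulVec]
    rw [← this, hc, star_smul, smul_dotProduct, dotProduct_smul, hz]
    simp
  set t := star v ⬝ᵥ u with ht
  have ht' : star u ⬝ᵥ v = star t := by rw [ht, star_dotProduct]
  have hww : star w ⬝ᵥ w = 2 - t - star t := by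
    simp only [hw, star_sub, sub_dotProduct, dotProduct_sub, hu, hv, ht', ← ht]
    ring
  have hcc : star c * c = 2 - t - star t := by rw [← hwc, hww]
  have hc0 : c ≠ 0 := by
    rintro rfl
    rw [zero_smul] at hc
    apply huv
    rw [← sub_eq_zero, ← hw, ← one_mulVec w, ← hPP, ← mulVec_mulVec, hc, mulVec_zero]
  have ht1 : 1 - t ≠ 0 := by
    intro h
    have h' : star c * c = 0 := by
      have : t = 1 := by linear_combination -h
      rw [hcc, this, star_one]; norm_num
    simp [hc0] at h'
  have ht1' : 1 - star t ≠ 0 := by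
    intro h
    apply ht1
    simpa using congrArg star h
  -- The eigenvalue of `R` at `w`. It has modulus one because `‖w‖² = 2 - t - star t`.
  set z := 1 - star c * c / (1 - t) with hzdef
  have hz' : z = - (1 - star t) / (1 - t) := by
    rw [hzdef, hcc]; field_simp; ring
  have hzz : z * star z = 1 := by
    rw [hz']
    simp only [star_div₀, star_neg, star_sub, star_one, star_star]
    field_simp
  have hR : Pᴴ * phaseGate Γ z * P = 1 - (1 - t)⁻¹ • vecMulVec w (star w) := by
    have e : w = c • (Pᴴ *ᵥ zeroVec Γ) := by
      rw [← mulVec_smul, ← hc, mulVec_mulVec, hPP, one_mulVec]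
    have e₂ : vecMulVec w (star w) = (star c * c) •
        (Pᴴ * vecMulVec (zeroVec Γ) (star (zeroVec Γ)) * P) := by
      conv_lhs => rw [e]
      rw [star_smul, smul_vecMulVec, vecMulVec_smul, smul_smul, mul_vecMulVec, vecMulVec_mul,
        star_mulVec, conjTranspose_conjTranspose, mul_comm]
    have e₃ : 1 - z = (1 - t)⁻¹ * (star c * c) := by rw [hzdef]; field_simp; ring
    rw [e₂, phaseGate, Matrix.mul_sub, Matrix.sub_mul, Matrix.mul_one, hPP, Matrix.mul_smul,
      Matrix.smul_mul, smul_smul, e₃]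
  have hD : (phaseGate Γ z)ᴴ * phaseGate Γ z = 1 := by
    have e : vecMulVec (zeroVec Γ) (star (zeroVec Γ)) * vecMulVec (zeroVec Γ) (star (zeroVec Γ)) =
        vecMulVec (zeroVec Γ) (star (zeroVec Γ)) := by
      rw [vecMulVec_mul_vecMulVec, hz]; simp
    simp only [phaseGate, conjTranspose_sub, conjTranspose_one, conjTranspose_smul,
      conjTranspose_vecMulVec, star_star, Matrix.mul_sub, Matrix.sub_mul, Matrix.mul_one,
      Matrix.one_mul, Matrix.smul_mul, Matrix.mul_smul, e, star_sub, star_one]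
    have : star z * z = 1 := by rw [mul_comm, hzz]
    rw [← sub_eq_zero]
    calc _ = (star z * z - 1) • vecMulVec (zeroVec Γ) (star (zeroVec Γ)) := by module
      _ = 0 := by rw [this, sub_self, zero_smul]
  refine ⟨Pᴴ * phaseGate Γ z * P, (hP'.mul (isCircuit_phaseGate hzz hΓ)).mul hP, ?_, ?_, ?_⟩
  · calc (Pᴴ * phaseGate Γ z * P)ᴴ * (Pᴴ * phaseGate Γ z * P)
        = Pᴴ * ((phaseGate Γ z)ᴴ * (P * Pᴴ) * phaseGate Γ z) * P := by
          simp only [conjTranspose_mul, conjTranspose_conjTranspose, Matrix.mul_assoc]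
      _ = 1 := by rw [hPP', Matrix.mul_one, hD, Matrix.mul_one, hPP]
  · have hwu : star w ⬝ᵥ u = 1 - t := by rw [hw, star_sub, sub_dotProduct, hu]
    rw [hR, sub_mulVec, one_mulVec, smul_mulVec, vecMulVec_mulVec, hwu]
    ext i
    simp only [hw, Pi.sub_apply, Pi.smul_apply, op_smul_eq_mul, smul_eq_mul]
    field_simp
    ring
  · intro x hx hx'
    have hwx : star w ⬝ᵥ x = 0 := by rw [hw, star_sub, sub_dotProduct, hx, hx', sub_zero]
    rw [hR, sub_mulVec, one_mulVec, smul_mulVec, vecMulVec_mulVec, hwx]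
    simp

/-- Columns are matched one at a time. By orthonormality, those already matched are orthogonal to
both the current and the target column, so the next reflection fixes them. -/
theorem exists_isCircuit_mul_eq {Γ : Finset X} (hΓ : Γ.Nonempty) {n : Type*} [Fintype n]
    [DecidableEq n] {A B : Matrix (Conf Γ) n ℂ} (hA : Aᴴ * A = 1) (hB : Bᴴ * B = 1) :
    ∃ W, IsCircuit Γ W ∧ W * A = B := by
  have col_dot {C : Matrix (Conf Γ) n ℂ} (hC : Cᴴ * C = 1) (i j : n) :
      star (C.col i) ⬝ᵥ C.col j = if i = j then 1 else 0 := by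
    rw [← one_apply, ← hC]; rfl
  have key (s : Finset n) : ∃ W, IsCircuit Γ W ∧ Wᴴ * W = 1 ∧ ∀ i ∈ s, (W * A).col i = B.col i := by
    induction s using Finset.induction_on with
    | empty => exact ⟨1, isCircuit_one Γ, by simp, by simp⟩
    | insert k s hk ih =>
      obtain ⟨W, hW, hWW, h⟩ := ih
      have hWA : (W * A)ᴴ * (W * A) = 1 := by
        rw [conjTranspose_mul, Matrix.mul_assoc, ← Matrix.mul_assoc Wᴴ, hWW, Matrix.one_mul, hA]
      obtain ⟨R, hR, hRR, hRu, hRx⟩ := exists_isCircuit_mulVec_eq hΓ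
        (u := (W * A).col k) (v := B.col k) (by simp [col_dot hWA]) (by simp [col_dot hB])
      refine ⟨R * W, hR.mul hW, ?_, fun i hi => ?_⟩
      · rw [conjTranspose_mul, Matrix.mul_assoc, ← Matrix.mul_assoc Rᴴ, hRR, Matrix.one_mul, hWW]
      · have e : (R * W * A).col i = R *ᵥ (W * A).col i := by rw [Matrix.mul_assoc]; rfl
        rw [e]
        rcases Finset.mem_insert.1 hi with rfl | hi
        · exact hRu
        · have hki : k ≠ i := fun e => hk (e ▸ hi)
          rw [hRx, h i hi]
          · rw [col_dot hWA, if_neg hki]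
          · rw [h i hi, col_dot hB, if_neg hki]
  obtain ⟨W, hW, -, h⟩ := key Finset.univ
  refine ⟨W, hW, ?_⟩
  ext b i
  exact congrFun (h i (Finset.mem_univ i)) b

end UnitarySynthesis

theorem exists_eq_conjTranspose_mul_self {n : Type*} [Fintype n] [DecidableEq n]
    {A : Matrix n n ℂ} (hA : A.PosSemidef) : ∃ B : Matrix n n ℂ, A = Bᴴ * B := by
  open scoped MatrixOrder Matrix.Norms.L2Operator in
  exact CStarAlgebra.nonneg_iff_eq_star_mul_self.1 hA.nonneg

/-! ### Realizing Kraus families by programs -/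

section Programs

variable {X : Type*} [DecidableEq X]

/-- Some program has the interpretation `p`. -/
def IsRealizable (Γ Δ : Finset X) (p : VPair (Conf Γ) (Conf Δ)) : Prop :=
  ∃ S, ∃ d : Derivation Γ S Δ, d.sem = p

theorem IsRealizable.comp {Γ Δ Λ : Finset X} {p : VPair (Conf Γ) (Conf Δ)}
    {p' : VPair (Conf Δ) (Conf Λ)} (h' : IsRealizable Δ Λ p') (h : IsRealizable Γ Δ p) :
    IsRealizable Γ Λ (p'.comp p) := by
  obtain ⟨S, d, rfl⟩ := h
  obtain ⟨S', d', rfl⟩ := h'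
  exact ⟨.seq S S', .seq d d', rfl⟩

theorem IsRealizable.pure_mul {Γ Δ Λ : Finset X} {M : Matrix (Conf Δ) (Conf Γ) ℂ}
    {N : Matrix (Conf Λ) (Conf Δ) ℂ} (h' : IsRealizable Δ Λ (.pure N))
    (h : IsRealizable Γ Δ (.pure M)) : IsRealizable Γ Λ (.pure (N * M)) := by
  rw [← VPair.pure_comp]
  exact h'.comp h

theorem IsCircuit.isRealizable {Γ : Finset X} {M : Matrix (Conf Γ) (Conf Γ) ℂ}
    (h : IsCircuit Γ M) : IsRealizable Γ Γ (.pure M) := by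
  obtain ⟨S, -, d, hd⟩ := h
  exact ⟨S, d, hd⟩

theorem isRealizable_ket {q : X} {Γ : Finset X} (hq : q ∉ Γ) :
    IsRealizable Γ (insert q Γ) (.pure (ket q Γ 0)) :=
  ⟨.newQbit q, .newQbit q Γ hq, rfl⟩

theorem isRealizable_discard {q : X} {Γ : Finset X} (hq : q ∉ Γ) :
    IsRealizable (insert q Γ) Γ
      (sandwich (bra q Γ 0) (bra q Γ 0) + sandwich (bra q Γ 1) (bra q Γ 1), bra q Γ 0) :=
  ⟨.discard q, .discard q Γ hq, rfl⟩

/-- The loop on `skip` terminates only on `|0⟩`, without changing the state. -/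
theorem isRealizable_proj {q : X} {Γ : Finset X} (hq : q ∈ Γ) :
    IsRealizable Γ Γ (.pure (proj hq 0)) :=
  ⟨.whileDo q .skip, .whileDo q hq (.skip Γ), (isLeastFixedPoint_pure_proj hq).lfp_eq⟩

/-- Postselection: projecting first kills the `⟨1|` branch of the discard, which has no vacuum
amplitude. -/
theorem isRealizable_bra {q : X} {Γ : Finset X} (hq : q ∉ Γ) :
    IsRealizable (insert q Γ) Γ (.pure (bra q Γ 0)) := by
  convert (isRealizable_discard hq).comp (isRealizable_proj (Finset.mem_insert_self q Γ)) using 1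
  have h₀ : bra q Γ 0 * proj (Finset.mem_insert_self q Γ) 0 = bra q Γ 0 := by
    rw [proj_insert hq, ← Matrix.mul_assoc, bra_mul_ket_self hq, Matrix.one_mul]
  have h₁ : bra q Γ 1 * proj (Finset.mem_insert_self q Γ) 0 = 0 := by
    rw [proj_insert hq, ← Matrix.mul_assoc, bra_mul_ket_of_ne hq one_ne_zero, Matrix.zero_mul]
  simp only [VPair.pure, VPair.comp, LinearMap.add_comp, sandwich_comp, h₀, h₁, sandwich_zero,
    add_zero]

/-- `J` adjoins `|0⟩` for each variable of `Λ` outside `Γ`; `Jᴴ` postselects these qubits on `|0⟩`.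
-/
theorem exists_isometry_isRealizable (Γ Λ : Finset X) :
    ∃ J : Matrix (Conf (Λ ∪ Γ)) (Conf Γ) ℂ, Jᴴ * J = 1 ∧
      IsRealizable Γ (Λ ∪ Γ) (.pure J) ∧ IsRealizable (Λ ∪ Γ) Γ (.pure Jᴴ) := by
  induction Λ using Finset.induction_on with
  | empty =>
    rw [Finset.empty_union]
    exact ⟨1, by simp, (isCircuit_one Γ).isRealizable,
      by simpa using (isCircuit_one Γ).isRealizable⟩
  | insert q Λ _ ih =>
    obtain ⟨J, hJ, h, h'⟩ := ih
    rw [Finset.insert_union]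
    by_cases hq : q ∈ Λ ∪ Γ
    · rw [Finset.insert_eq_of_mem hq]
      exact ⟨J, hJ, h, h'⟩
    · refine ⟨ket q (Λ ∪ Γ) 0 * J, ?_, (isRealizable_ket hq).pure_mul h, ?_⟩
      · rw [conjTranspose_mul, Matrix.mul_assoc, ← Matrix.mul_assoc _ (ket _ _ _) J]
        have := bra_mul_ket_self hq 0
        rw [bra] at this
        rw [this, Matrix.one_mul, hJ]
      · rw [conjTranspose_mul]
        exact h'.pure_mul (isRealizable_bra hq)

theorem isRealizable_pure_isometry [Infinite X] {Γ Δ : Finset X} {V : Matrix (Conf Δ) (Conf Γ) ℂ}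
    (hV : Vᴴ * V = 1) : IsRealizable Γ Δ (.pure V) := by
  -- Any variable serves: `f` only makes the common environment nonempty, even when `Γ` and `Δ` are
  -- both empty.
  obtain ⟨f, hf⟩ := Infinite.exists_notMem_finset (∅ : Finset X)
  obtain ⟨A, hA, hA', -⟩ := exists_isometry_isRealizable Γ (insert f Δ)
  have hB : ∃ B : Matrix (Conf (insert f Δ ∪ Γ)) (Conf Δ) ℂ, Bᴴ * B = 1 ∧
      IsRealizable (insert f Δ ∪ Γ) Δ (.pure Bᴴ) := by
    obtain ⟨B, hB, -, hB'⟩ := exists_isometry_isRealizable Δ (insert f Γ)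
    have e : insert f Γ ∪ Δ = insert f Δ ∪ Γ := by
      rw [Finset.insert_union, Finset.insert_union, Finset.union_comm]
    rw [← e]
    exact ⟨B, hB, hB'⟩
  obtain ⟨B, hB, hB'⟩ := hB
  have hBV : (B * V)ᴴ * (B * V) = 1 := by
    rw [conjTranspose_mul, Matrix.mul_assoc, ← Matrix.mul_assoc Bᴴ, hB, Matrix.one_mul, hV]
  -- With `W A = B V`, postselecting gives `Bᴴ W A = Bᴴ B V = V`.
  obtain ⟨W, hW, hWA⟩ := exists_isCircuit_mul_eq ⟨f, by simp⟩ hA hBV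
  have h := hB'.pure_mul (hW.isRealizable.pure_mul hA')
  rwa [hWA, ← Matrix.mul_assoc, hB, Matrix.one_mul] at h

theorem sum_range_two_pow_succ {M : Type*} [AddCommMonoid M] (f : ℕ → M) (n : ℕ) :
    ∑ i ∈ Finset.range (2 ^ (n + 1)), f i =
      ∑ i ∈ Finset.range (2 ^ n), (f (2 * i) + f (2 * i + 1)) := by
  rw [pow_succ, mul_comm]
  induction 2 ^ n with
  | zero => simp
  | succ k ih =>
    rw [show 2 * (k + 1) = 2 * k + 1 + 1 by ring, Finset.sum_range_succ, Finset.sum_range_succ,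
      Finset.sum_range_succ, ih, add_assoc]

/-- Consecutive Kraus operators are merged as `|0⟩ ⊗ K₂ᵢ + |1⟩ ⊗ K₂ᵢ₊₁`, halving their number, and
discarding the new qubit separates them. Index `0` always lies on the `⟨0|` side, so `K 0` keeps the
vacuum amplitude. -/
theorem isRealizable_kraus_range [Infinite X] (n : ℕ) {Γ Δ : Finset X}
    (K : ℕ → Matrix (Conf Δ) (Conf Γ) ℂ) (hK : ∑ i ∈ Finset.range (2 ^ n), (K i)ᴴ * K i = 1) :
    IsRealizable Γ Δ (∑ i ∈ Finset.range (2 ^ n), sandwich (K i) (K i), K 0) := by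
  induction n generalizing Δ with
  | zero =>
    simp only [pow_zero, Finset.sum_range_one] at hK ⊢
    exact isRealizable_pure_isometry hK
  | succ n ih =>
    obtain ⟨q, hq⟩ := Infinite.exists_notMem_finset Δ
    let L (i : ℕ) : Matrix (Conf (insert q Δ)) (Conf Γ) ℂ :=
      ket q Δ 0 * K (2 * i) + ket q Δ 1 * K (2 * i + 1)
    have h₀ (i : ℕ) : bra q Δ 0 * L i = K (2 * i) := by
      simp [L, Matrix.mul_add, ← Matrix.mul_assoc, bra_mul_ket_self hq, bra_mul_ket_of_ne hq]
    have h₁ (i : ℕ) : bra q Δ 1 * L i = K (2 * i + 1) := by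
      simp [L, Matrix.mul_add, ← Matrix.mul_assoc, bra_mul_ket_self hq, bra_mul_ket_of_ne hq]
    have hL (i : ℕ) : (L i)ᴴ * L i =
        (K (2 * i))ᴴ * K (2 * i) + (K (2 * i + 1))ᴴ * K (2 * i + 1) := by
      have e : (L i)ᴴ = (K (2 * i))ᴴ * bra q Δ 0 + (K (2 * i + 1))ᴴ * bra q Δ 1 := by
        simp only [L, bra, conjTranspose_add, conjTranspose_mul]
      rw [e, Matrix.add_mul, Matrix.mul_assoc, Matrix.mul_assoc, h₀, h₁]
    rw [sum_range_two_pow_succ] at hK ⊢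
    have h := (isRealizable_discard hq).comp (ih L (by simpa only [hL] using hK))
    convert h using 1
    refine Prod.ext ?_ (h₀ 0).symm
    simp only [VPair.comp, LinearMap.add_comp]
    refine LinearMap.ext fun ρ => ?_
    simp only [LinearMap.add_apply, LinearMap.comp_apply, LinearMap.sum_apply, map_sum,
      ← Finset.sum_add_distrib]
    refine Finset.sum_congr rfl fun i _ => ?_
    simp only [← LinearMap.comp_apply, sandwich_comp, h₀, h₁]

theorem isRealizable_kraus [Infinite X] {ι : Type*} [Fintype ι] {Γ Δ : Finset X}
    (F : Matrix (Conf Δ) (Conf Γ) ℂ) (K : ι → Matrix (Conf Δ) (Conf Γ) ℂ)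
    (hK : Fᴴ * F + ∑ i, (K i)ᴴ * K i = 1) :
    IsRealizable Γ Δ (sandwich F F + ∑ i, sandwich (K i) (K i), F) := by
  let e := Fintype.equivFin ι
  let N := Fintype.card ι
  -- `F` takes index `0`, the one with vacuum amplitude; zeros pad the family to a power of two.
  let L : ℕ → Matrix (Conf Δ) (Conf Γ) ℂ
    | 0 => F
    | i + 1 => if h : i < N then K (e.symm ⟨i, h⟩) else 0
  have key {M : Type _} [AddCommMonoid M] (f : Matrix (Conf Δ) (Conf Γ) ℂ → M) (hf : f 0 = 0) :
      ∑ i ∈ Finset.range (2 ^ (N + 1)), f (L i) = f F + ∑ i, f (K i) := by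
    obtain ⟨r, hr⟩ : ∃ r, 2 ^ (N + 1) = N + r + 1 := by
      have : N + 1 < 2 ^ (N + 1) := Nat.lt_two_pow_self
      exact ⟨2 ^ (N + 1) - (N + 1), by omega⟩
    rw [hr, Finset.sum_range_succ', add_comm, Finset.sum_range_add, ← Equiv.sum_comp e.symm,
      Finset.sum_range]
    congr 1
    rw [Finset.sum_eq_zero (s := Finset.range r), add_zero]
    · exact Finset.sum_congr rfl fun i _ => by simp [L]
    · intro i _; simp [L, hf]
  have h := isRealizable_kraus_range (N + 1) L (by
    rw [key (fun A => Aᴴ * A) (by simp)]; exact hK)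
  rwa [key (fun A => sandwich A A) sandwich_zero] at h

theorem isRealizable_kraus_of_posSemidef [Infinite X] {ι : Type*} [Fintype ι] {Γ Δ : Finset X}
    (F : Matrix (Conf Δ) (Conf Γ) ℂ) (K : ι → Matrix (Conf Δ) (Conf Γ) ℂ)
    (hK : (1 - (Fᴴ * F + ∑ i, (K i)ᴴ * K i)).PosSemidef) :
    IsRealizable Γ Δ (sandwich F F + ∑ i, sandwich (K i) (K i), F) := by
  obtain ⟨B, hB⟩ := exists_eq_conjTranspose_mul_self hK
  obtain ⟨q, hq⟩ := Infinite.exists_notMem_finset Δ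
  -- The rows of `B` become operators into a fixed basis state of `Δ`, so that their total weight is
  -- the defect `Bᴴ * B`.
  let R (c : Conf Γ) : Matrix (Conf Δ) (Conf Γ) ℂ := vecMulVec (Pi.single 0 1) (B c)
  have hR : ∑ c, (R c)ᴴ * R c = Bᴴ * B := by
    ext i j
    simp [R, Matrix.sum_apply, conjTranspose_vecMulVec, vecMulVec_mul_vecMulVec, vecMulVec_apply,
      mul_apply]
  -- The flag `q` is `0` on the wanted operators and `1` on the completion, so that `⟨0|` discards
  -- the latter.
  let L : ι ⊕ Conf Γ → Matrix (Conf (insert q Δ)) (Conf Γ) ℂ :=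
    Sum.elim (fun i => ket q Δ 0 * K i) (fun c => ket q Δ 1 * R c)
  have hk (k : Fin 2) (A : Matrix (Conf Δ) (Conf Γ) ℂ) :
      (ket q Δ k * A)ᴴ * (ket q Δ k * A) = Aᴴ * A := by
    have := bra_mul_ket_self hq k
    rw [bra] at this
    rw [conjTranspose_mul, Matrix.mul_assoc, ← Matrix.mul_assoc _ _ A, this, Matrix.one_mul]
  have h := isRealizable_kraus (ket q Δ 0 * F) L (by
    simp only [Fintype.sum_sum_type, L, Sum.elim_inl, Sum.elim_inr, hk, hR, ← hB]
    abel)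
  convert (isRealizable_bra hq).comp h using 1
  have h₀ (A : Matrix (Conf Δ) (Conf Γ) ℂ) : bra q Δ 0 * (ket q Δ 0 * A) = A := by
    rw [← Matrix.mul_assoc, bra_mul_ket_self hq, Matrix.one_mul]
  have h₁ (A : Matrix (Conf Δ) (Conf Γ) ℂ) : bra q Δ 0 * (ket q Δ 1 * A) = 0 := by
    rw [← Matrix.mul_assoc, bra_mul_ket_of_ne hq zero_ne_one, Matrix.zero_mul]
  refine Prod.ext ?_ (h₀ F).symm
  refine LinearMap.ext fun ρ => ?_
  simp only [VPair.comp, VPair.pure, Fintype.sum_sum_type, L, Sum.elim_inl, Sum.elim_inr,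
    LinearMap.comp_apply, LinearMap.add_apply, LinearMap.sum_apply, map_add, map_sum]
  simp only [← LinearMap.comp_apply, sandwich_comp, h₀, h₁, sandwich_zero, LinearMap.zero_apply,
    Finset.sum_const_zero, add_zero]

end Programs

/-! ### Kraus form of vacuum-extended operations -/

section Kraus

variable {m n : Type*} [Fintype m] [Fintype n] [DecidableEq n]

theorem sandwich_single_one_apply (A : Matrix m n ℂ) (a b : n) (i j : m) :
    sandwich A A (single a b 1) i j = A i a * star (A j b) := by
  rw [sandwich_apply, single_eq_single_vecMulVec_single, mul_vecMulVec, vecMulVec_mul,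
    vecMulVec_apply]
  simp

/-- Complete positivity of `C` alone yields only some Kraus family; the coherence with the vacuum
singles out `F`, through the Schur complement of the vacuum entry. -/
theorem vacOps.exists_kraus {C : Matrix n n ℂ →ₗ[ℂ] Matrix m m ℂ} {F : Matrix m n ℂ}
    (h : (C, F) ∈ vacOps n m) :
    ∃ K : m × n → Matrix m n ℂ, C = sandwich F F + ∑ i, sandwich (K i) (K i) := by
  classical
  let e := Fintype.equivFin (n ⊕ Unit)
  -- Unnormalized maximally entangled vector; `e` numbers the basis because auxiliary systems are
  -- indexed by `Fin k`.
  let ω : (n ⊕ Unit) × Fin (Fintype.card (n ⊕ Unit)) → ℂ := fun p => if e p.1 = p.2 then 1 else 0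
  have hY := h.2.completelyPositive _ _ (posSemidef_vecMulVec_self_star ω)
  -- Of all pairs of output and reference indices, only those with both or neither in the vacuum
  -- matter.
  let g : (m × n) ⊕ Unit → (m ⊕ Unit) × Fin (Fintype.card (n ⊕ Unit)) :=
    Sum.elim (fun p => (Sum.inl p.1, e (Sum.inl p.2))) (fun _ => (Sum.inr (), e (Sum.inr ())))
  let J : Matrix (m × n) (m × n) ℂ := fun p p' => C (single p.2 p'.2 1) p.1 p'.1
  let f : Matrix (m × n) Unit ℂ := fun p _ => F p.1 p.2
  have hω (a b : n ⊕ Unit) : (of fun c d => vecMulVec ω (star ω) (c, e a) (d, e b)) =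
      single a b (1 : ℂ) := by
    ext c d
    by_cases h₁ : a = c <;> by_cases h₂ : b = d <;>
      simp [vecMulVec_apply, ω, h₁, h₂, eq_comm]
  have hamp (x y : m ⊕ Unit) (a b : n ⊕ Unit) :
      ampliate (vacExt (C, F)) _ (vecMulVec ω (star ω)) (x, e a) (y, e b) =
        vacExt (C, F) (single a b 1) x y := by
    rw [ampliate, of_apply, hω]
  have hsub : ((ampliate (vacExt (C, F)) _ (vecMulVec ω (star ω))).submatrix g g) =
      fromBlocks J f fᴴ 1 := by
    ext (p | p) (p' | p')
    · refine (hamp (Sum.inl p.1) (Sum.inl p'.1) (Sum.inl p.2) (Sum.inl p'.2)).trans ?_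
      have : (single (Sum.inl p.2) (Sum.inl p'.2) 1 :
          Matrix (n ⊕ Unit) (n ⊕ Unit) ℂ).toBlocks₁₁ = single p.2 p'.2 1 := by
        ext c d
        simp [toBlocks₁₁, single_apply]
      change C (single (Sum.inl p.2) (Sum.inl p'.2) 1 :
          Matrix (n ⊕ Unit) (n ⊕ Unit) ℂ).toBlocks₁₁ p.1 p'.1 = C (single p.2 p'.2 1) p.1 p'.1
      rw [this]
    · refine (hamp (Sum.inl p.1) (Sum.inr ()) (Sum.inl p.2) (Sum.inr ())).trans ?_
      change (F * (single (Sum.inl p.2) (Sum.inr ()) 1 :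
          Matrix (n ⊕ Unit) (n ⊕ Unit) ℂ).toBlocks₁₂) p.1 () = F p.1 p.2
      simp [mul_apply, toBlocks₁₂, single_apply]
    · refine (hamp (Sum.inr ()) (Sum.inl p'.1) (Sum.inr ()) (Sum.inl p'.2)).trans ?_
      change ((single (Sum.inr ()) (Sum.inl p'.2) 1 :
          Matrix (n ⊕ Unit) (n ⊕ Unit) ℂ).toBlocks₂₁ * Fᴴ) () p'.1 = star (F p'.1 p'.2)
      simp [mul_apply, toBlocks₂₁, single_apply]
    · refine (hamp (Sum.inr ()) (Sum.inr ()) (Sum.inr ()) (Sum.inr ())).trans ?_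
      change (single (Sum.inr ()) (Sum.inr ()) 1 :
          Matrix (n ⊕ Unit) (n ⊕ Unit) ℂ).toBlocks₂₂ () () =
        (1 : Matrix Unit Unit ℂ) p p'
      simp [toBlocks₂₂]
  have hblock : (fromBlocks J f fᴴ 1).PosSemidef := hsub ▸ hY.submatrix g
  let _ : Invertible (1 : Matrix Unit Unit ℂ) := invertibleOne
  rw [PosDef.one.fromBlocks₂₂ J f] at hblock
  obtain ⟨B, hB⟩ := exists_eq_conjTranspose_mul_self hblock
  -- Each row of the factor `B` of `J - f f†`, conjugated and reshaped, is a Kraus operator.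
  refine ⟨fun r => of fun i a => star (B r (i, a)), ?_⟩
  refine Matrix.ext_linearMap ℂ fun a b => ?_
  ext i j
  rw [inv_one, Matrix.mul_one] at hB
  have hij : C (single a b 1) i j - (f * fᴴ) (i, a) (j, b) = (Bᴴ * B) (i, a) (j, b) := by
    rw [← hB]; rfl
  rw [sub_eq_iff_eq_add'] at hij
  change C (single a b 1) i j = _
  rw [hij, LinearMap.comp_apply, LinearMap.add_apply, LinearMap.sum_apply, Matrix.add_apply,
    Matrix.sum_apply]
  change _ = sandwich F F (single a b 1) i j + ∑ r, sandwich _ _ (single a b 1) i j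
  simp only [sandwich_single_one_apply]
  have hf : (f * fᴴ) (i, a) (j, b) = F i a * star (F j b) := by
    rw [mul_apply, Fintype.sum_unique]; rfl
  rw [hf]
  simp [mul_apply]

/-- On `v v†`, the trace inequality reads `⟨v, (1 - A) v⟩ ≥ 0` with `A = F†F + ∑ Kᵢ†Kᵢ`. -/
theorem posSemidef_one_sub_of_trace_le {ι : Type*} [Fintype ι] {C : Matrix n n ℂ →ₗ[ℂ] Matrix m m ℂ}
    {K : ι → Matrix m n ℂ} (hC : ∀ ρ : Matrix n n ℂ, ρ.PosSemidef → (C ρ).trace ≤ ρ.trace)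
    {F : Matrix m n ℂ} (h : C = sandwich F F + ∑ i, sandwich (K i) (K i)) :
    (1 - (Fᴴ * F + ∑ i, (K i)ᴴ * K i)).PosSemidef := by
  have hs (A : Matrix m n ℂ) (ρ : Matrix n n ℂ) : (sandwich A A ρ).trace = (Aᴴ * A * ρ).trace := by
    rw [sandwich_apply, Matrix.mul_assoc, trace_mul_comm, Matrix.mul_assoc, trace_mul_comm]
  refine PosSemidef.of_dotProduct_mulVec_nonneg ?_ fun v => ?_
  · rw [IsHermitian, conjTranspose_sub, conjTranspose_add, conjTranspose_sum]
    simp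
  · have h₁ := hC _ (posSemidef_vecMulVec_self_star v)
    rw [← sub_nonneg] at h₁
    convert h₁ using 1
    have h₂ : (C (vecMulVec v (star v))).trace =
        ((Fᴴ * F + ∑ i, (K i)ᴴ * K i) * vecMulVec v (star v)).trace := by
      rw [h]
      simp only [LinearMap.add_apply, LinearMap.sum_apply, trace_add, trace_sum, hs, Matrix.add_mul,
        Matrix.sum_mul]
    rw [h₂, ← trace_sub]
    generalize Fᴴ * F + ∑ i, (K i)ᴴ * K i = A
    rw [sub_mulVec, one_mulVec, dotProduct_sub, mul_vecMulVec, trace_sub, trace_vecMulVec,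
      trace_vecMulVec, dotProduct_comm, dotProduct_comm (A *ᵥ v)]

end Kraus

end QLang

theorem theorem1 {X : Type*} [DecidableEq X] [Countable X] [Infinite X] (Γ Δ : Finset X)
    (C : Matrix (QLang.Conf Γ) (QLang.Conf Γ) ℂ →ₗ[ℂ] Matrix (QLang.Conf Δ) (QLang.Conf Δ) ℂ)
    (F : Matrix (QLang.Conf Δ) (QLang.Conf Γ) ℂ)
    (hCF : (C, F) ∈ QLang.vacOps (QLang.Conf Γ) (QLang.Conf Δ)) :
    ∃ (S : QLang.Stmt X) (h : QLang.IsProgram Γ S Δ), QLang.sem h = (C, F) := by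
  obtain ⟨K, hK⟩ := QLang.vacOps.exists_kraus hCF
  obtain ⟨S, d, hd⟩ := QLang.isRealizable_kraus_of_posSemidef F K
    (QLang.posSemidef_one_sub_of_trace_le hCF.1.trace_le hK)
  exact ⟨S, ⟨d⟩, (QLang.sem_eq _ d).trans (hd.trans (by rw [hK]))⟩
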